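/- **Theorem.** Let $M$ be a Riemann surface with complex structure $I$, let $m_0\in M$, and let $(g,\nabla)$ be an affine special Kähler structure on $M\setminus\{m_0\}$ (so possibly singular at $m_0$). That is, $g$ is a Kähler metric with Kähler form $\omega(\cdot,\cdot)=g(I\cdot,\cdot)$, and $\nabla$ is a flat, torsion-free connection on the real tangent bundle with $\nabla\omega=0$ and $(\nabla_XI)Y=(\nabla_YI)X$ for all vector fields $X,Y$. Let $\Xi=-\omega(\pi^{(1,0)},\nabla\pi^{(1,0)})$ be the associated holomorphic cubic form, where $\pi^{(1,0)}$ is the projection onto vectors of type $(1,0)$. Assume that $\Xi$ has finite order $n\in\mathbb Z$ at $m_0$, i.e. it is meromorphic at $m_0$, not identically zero near $m_0$, and of order $n$ there. Let $z=x+iy=re^{i\theta}$ be a local holomorphic coordinate near $m_0$ with $z(m_0)=0$, and put $\rho=\log r$. Write $g=w\,|dz|^2$ and $\nabla=d+\omega_\nabla$, where $\omega_\nabla$ is the $2\times 2$ matrix of real one-forms with respect to the frame $(\partial_x,\partial_y)$. Let $\mathbb 1_2$ be the identity matrix and $\mathrm I_2=\begin{pmatrix}0&-1\\1&0\end{pmatrix}$.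 All asymptotics below are for $r\to0$ (i.e. $\rho\to-\infty$), uniformly in $\theta$ and entrywise. 1. If $w=r^\beta(C+o(1))$ for some real $\beta<n+1$ and $C>0$, then there exists $\varepsilon>0$ such that $$\omega_\nabla=\tfrac{\beta}{2}\bigl(\mathbb 1_2\,d\rho+\mathrm I_2\,d\theta\bigr)+o(1)\,d\theta+o(e^{\varepsilon\rho})\,d\rho .$$ 2. If $w=-r^{n+1}\log r\,(C+o(1))$ for some $C>0$, then there exists $b\in\mathbb C$ with $|b|=1$ such that, with $k=n+1$ and $B=be^{ik\theta}$, $$\begin{aligned}\omega_\nabla={}&\tfrac12\left(k\,\mathrm I_2+\begin{pmatrix}\operatorname{Im}B&-1+\operatorname{Re}B\\1+\operatorname{Re}B&-\operatorname{Im}B\end{pmatrix}\rho^{-1}\right)d\theta\\&+\tfrac12\left(k\,\mathbb 1_2+\begin{pmatrix}1-\operatorname{Re}B&\operatorname{Im}B\\\operatorname{Im}B&1+\operatorname{Re}B\end{pmatrix}\rho^{-1}\right)d\rho\\&+o(\rho^{-1})\,d\theta+o(\rho^{-1})\,d\rho .\end{aligned}$$ -/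

import Mathlib

open Set Filter Topology Asymptotics
open scoped Manifold ContDiff Matrix

noncomputable section

namespace SpecialKahler

/-- A one-dimensional complex manifold is in particular a real manifold modelled on `ℂ`. -/
instance realManifold {n : WithTop ℕ∞} {M : Type*} [TopologicalSpace M] [ChartedSpace ℂ M]
    [h : IsManifold 𝓘(ℂ, ℂ) n M] : IsManifold 𝓘(ℝ, ℂ) n M := by
  refine isManifold_of_contDiffOn _ _ _ fun e e' he he' => ?_
  have h1 := (contDiffGroupoid n 𝓘(ℂ, ℂ)).compatible he he'
  rw [contDiffGroupoid, mem_groupoid_of_pregroupoid] at h1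
  exact ContDiffOn.restrict_scalars ℝ h1.1

section Fields

variable {M : Type*} [TopologicalSpace M] [ChartedSpace ℂ M]

/-- The real tangent space of the surface at `p`. -/
abbrev TM (p : M) : Type := TangentSpace 𝓘(ℝ, ℂ) p

/-- The almost complex structure `I`. In Mathlib the tangent space at `p` is a copy of the model
space `ℂ`, through the preferred holomorphic chart at `p`; `I` is multiplication by `i`. -/
def cplx (p : M) : TM p →L[ℝ] TM p :=
  (Complex.I • ContinuousLinearMap.id ℝ ℂ : ℂ →L[ℝ] ℂ)

/-- The vector field `X` is smooth on the set `V`. -/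
def SmoothField [IsManifold 𝓘(ℝ, ℂ) 1 M] (X : ∀ p : M, TM p) (V : Set M) : Prop :=
  ContMDiffOn 𝓘(ℝ, ℂ) 𝓘(ℝ, ℂ).tangent ∞ (fun p => (⟨p, X p⟩ : TangentBundle 𝓘(ℝ, ℂ) M)) V

end Fields

/-- An affine special Kähler structure `(g, ∇)` on the open subset `U` of a Riemann surface `M`.
Nothing is required of `g` and `∇` outside `U`. The value of `∇_X Y` at `p` is written
`cov Y p (X p)`. Since the real dimension is two, the form `ω = g(I ·, ·)` is automatically closed,
so that a metric `g` for which `I` is orthogonal is automatically Kähler. -/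
structure SpecialKahlerOn {M : Type*} [TopologicalSpace M] [ChartedSpace ℂ M]
    [IsManifold 𝓘(ℂ, ℂ) ω M] (U : Set M) where
  /-- The Riemannian metric. -/
  g : ∀ p : M, TM p →L[ℝ] TM p →L[ℝ] ℝ
  /-- The connection on the tangent bundle. -/
  cov : (∀ p : M, TM p) → ∀ p : M, TM p →L[ℝ] TM p
  g_smooth : ContMDiffOn 𝓘(ℝ, ℂ) (𝓘(ℝ, ℂ).prod 𝓘(ℝ, ℂ →L[ℝ] ℂ →L[ℝ] ℝ)) ∞
    (fun p => Bundle.TotalSpace.mk' (ℂ →L[ℝ] ℂ →L[ℝ] ℝ)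
      (E := fun p : M => TM p →L[ℝ] TM p →L[ℝ] ℝ) p (g p)) U
  g_symm : ∀ p ∈ U, ∀ v w : TM p, g p v w = g p w v
  g_pos : ∀ p ∈ U, ∀ v : TM p, v ≠ 0 → 0 < g p v v
  /-- `I` is orthogonal. -/
  g_cplx : ∀ p ∈ U, ∀ v w : TM p, g p (cplx p v) (cplx p w) = g p v w
  cov_isCovariantDerivative : IsCovariantDerivativeOn ℂ cov U
  cov_smooth : ∀ V ⊆ U, IsOpen V → ContMDiffCovariantDerivativeOn (I := 𝓘(ℝ, ℂ)) ℂ ∞ cov V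
  /-- `∇` is torsion-free: `∇_X Y - ∇_Y X = [X, Y]`. -/
  torsion_free : ∀ V ⊆ U, IsOpen V → ∀ X Y : ∀ p : M, TM p, SmoothField X V → SmoothField Y V →
    ∀ p ∈ V, cov Y p (X p) - cov X p (Y p) = VectorField.mlieBracket 𝓘(ℝ, ℂ) X Y p
  /-- `∇` is flat: `∇_X ∇_Y Z - ∇_Y ∇_X Z - ∇_[X,Y] Z = 0`. -/
  flat : ∀ V ⊆ U, IsOpen V → ∀ X Y Z : ∀ p : M, TM p,
    SmoothField X V → SmoothField Y V → SmoothField Z V →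
    ∀ p ∈ V, cov (fun q => cov Z q (Y q)) p (X p) - cov (fun q => cov Z q (X q)) p (Y p)
      - cov Z p (VectorField.mlieBracket 𝓘(ℝ, ℂ) X Y p) = 0
  /-- `∇` is symplectic: `X (ω(Y, Z)) = ω(∇_X Y, Z) + ω(Y, ∇_X Z)` for `ω = g(I ·, ·)`. -/
  symplectic : ∀ V ⊆ U, IsOpen V → ∀ X Y Z : ∀ p : M, TM p,
    SmoothField X V → SmoothField Y V → SmoothField Z V →
    ∀ p ∈ V, mvfderiv 𝓘(ℝ, ℂ) (fun q => g q (cplx q (Y q)) (Z q)) p (X p)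
      = g p (cplx p (cov Y p (X p))) (Z p) + g p (cplx p (Y p)) (cov Z p (X p))
  /-- `(∇_X I) Y = (∇_Y I) X`. -/
  special : ∀ V ⊆ U, IsOpen V → ∀ X Y : ∀ p : M, TM p, SmoothField X V → SmoothField Y V →
    ∀ p ∈ V, cov (fun q => cplx q (Y q)) p (X p) - cplx p (cov Y p (X p))
      = cov (fun q => cplx q (X q)) p (Y p) - cplx p (cov X p (Y p))

namespace SpecialKahlerOn

variable {M : Type*} [TopologicalSpace M] [ChartedSpace ℂ M] [IsManifold 𝓘(ℂ, ℂ) ω M] {U : Set M}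

/-- The symplectic form `ω = g(I ·, ·)`. -/
def kahlerForm (S : SpecialKahlerOn U) (p : M) (v w : TM p) : ℝ := S.g p (cplx p v) w

/-- The complex bilinear extension of `ω` to the complexified tangent space; the pair `(v, w)`
stands for `v + i w`. -/
def kahlerFormC (S : SpecialKahlerOn U) (p : M) (v w : TM p × TM p) : ℂ :=
  ⟨S.kahlerForm p v.1 w.1 - S.kahlerForm p v.2 w.2,
    S.kahlerForm p v.1 w.2 + S.kahlerForm p v.2 w.1⟩

/-- The projection `π^(1,0) X = (X - i I X) / 2` of a real vector field, as the pair of its real and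
imaginary parts. -/
def proj (X : ∀ p : M, TM p) : (∀ p : M, TM p) × (∀ p : M, TM p) :=
  (fun p => (1 / 2 : ℝ) • X p, fun p => -((1 / 2 : ℝ) • cplx p (X p)))

/-- `(∇_Y π^(1,0)) Z = ∇_Y (π^(1,0) Z) - π^(1,0) (∇_Y Z)`, where `∇` acts on the real and imaginary
parts separately. -/
def covProj (S : SpecialKahlerOn U) (Y Z : ∀ p : M, TM p) (p : M) : TM p × TM p :=
  (S.cov (proj Z).1 p (Y p) - (proj fun q => S.cov Z q (Y q)).1 p,
    S.cov (proj Z).2 p (Y p) - (proj fun q => S.cov Z q (Y q)).2 p)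

/-- The holomorphic cubic form `Ξ = -ω(π^(1,0), ∇ π^(1,0))`, evaluated on real vector fields. -/
def cubicForm (S : SpecialKahlerOn U) (X Y Z : ∀ p : M, TM p) (p : M) : ℂ :=
  -S.kahlerFormC p ((proj X).1 p, (proj X).2 p) (S.covProj Y Z p)

/-- The vector field which is constant, equal to `v`, in the coordinate `z`: for `v = 1` it is
`∂_x` and for `v = i` it is `∂_y`, where `z = x + i y`. -/
def coordField (z : OpenPartialHomeomorph M ℂ) (v : ℂ) : ∀ p : M, TM p :=
  VectorField.mpullback 𝓘(ℝ, ℂ) 𝓘(ℝ, ℂ) z (fun _ => v)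

/-- The function `w` with `g = w |dz|²` in the coordinate `z`. -/
def metricCoeff (S : SpecialKahlerOn U) (z : OpenPartialHomeomorph M ℂ) (ζ : ℂ) : ℝ :=
  S.g (z.symm ζ) (coordField z 1 (z.symm ζ)) (coordField z 1 (z.symm ζ))

/-- The function `Ξ₀` with `Ξ = Ξ₀ dz³` in the coordinate `z`. -/
def cubicCoeff (S : SpecialKahlerOn U) (z : OpenPartialHomeomorph M ℂ) (ζ : ℂ) : ℂ :=
  S.cubicForm (coordField z 1) (coordField z 1) (coordField z 1) (z.symm ζ)

/-- In the coordinate `z`, the value `ω_∇(ξ) v = dz (∇_ξ v)` of the connection form at the point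
`ζ`, where `ξ` and `v` are extended to constant vector fields. -/
def connVec (S : SpecialKahlerOn U) (z : OpenPartialHomeomorph M ℂ) (ζ ξ v : ℂ) : ℂ :=
  mfderiv 𝓘(ℝ, ℂ) 𝓘(ℝ, ℂ) z (z.symm ζ)
    (S.cov (coordField z v) (z.symm ζ) (coordField z ξ (z.symm ζ)))

/-- The connection one-form `ω_∇` of `∇` with respect to the trivialization `(∂_x, ∂_y)`, evaluated
at the point `ζ` on the tangent vector `ξ`. Its columns are the coordinates of `∇_ξ ∂_x` and of
`∇_ξ ∂_y`. -/
def connForm (S : SpecialKahlerOn U) (z : OpenPartialHomeomorph M ℂ) (ζ ξ : ℂ) :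
    Matrix (Fin 2) (Fin 2) ℝ :=
  !![(S.connVec z ζ ξ 1).re, (S.connVec z ζ ξ Complex.I).re;
     (S.connVec z ζ ξ 1).im, (S.connVec z ζ ξ Complex.I).im]

/-- The holomorphic cubic form has finite order `n` at the origin of the coordinate `z`, that is,
it is meromorphic there, not identically zero, and of order `n`. -/
def HasCubicOrder (S : SpecialKahlerOn U) (z : OpenPartialHomeomorph M ℂ) (n : ℤ) : Prop :=
  MeromorphicAt (S.cubicCoeff z) 0 ∧ meromorphicOrderAt (S.cubicCoeff z) 0 = (n : WithTop ℤ)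

end SpecialKahlerOn

/-- `ρ = log r`. -/
def rho (ζ : ℂ) : ℝ := Real.log ‖ζ‖

/-- The one-form `dρ = Re (dz / z)` on the punctured plane. -/
def dRho (ζ ξ : ℂ) : ℝ := (ξ / ζ).re

/-- The one-form `dθ = Im (dz / z)` on the punctured plane. -/
def dTheta (ζ ξ : ℂ) : ℝ := (ξ / ζ).im

/-- The matrix of the complex structure in the basis `(∂_x, ∂_y)`. -/
def matI : Matrix (Fin 2) (Fin 2) ℝ := !![0, -1; 1, 0]

/-- The connection form `(β / 2) (1 dρ + I dθ)` of the flat cone `r^β |dz|²`. -/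
def flatConeForm (β : ℝ) (ζ ξ : ℂ) : Matrix (Fin 2) (Fin 2) ℝ :=
  (β / 2) • (dRho ζ ξ • (1 : Matrix (Fin 2) (Fin 2) ℝ) + dTheta ζ ξ • matI)

/-- `b e^(ikθ)`. -/
def phase (k : ℤ) (b ζ : ℂ) : ℂ := b * (ζ / (‖ζ‖ : ℂ)) ^ k

/-- The connection form of the model logarithmic singularity with metric `-C r^k log r |dz|²`. -/
def logForm (k : ℤ) (b ζ ξ : ℂ) : Matrix (Fin 2) (Fin 2) ℝ :=
  dTheta ζ ξ • ((1 / 2 : ℝ) • ((k : ℝ) • matI + (rho ζ)⁻¹ •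
    !![(phase k b ζ).im, -1 + (phase k b ζ).re;
       1 + (phase k b ζ).re, -(phase k b ζ).im]))
  + dRho ζ ξ • ((1 / 2 : ℝ) • ((k : ℝ) • (1 : Matrix (Fin 2) (Fin 2) ℝ) + (rho ζ)⁻¹ •
    !![1 - (phase k b ζ).re, (phase k b ζ).im;
       (phase k b ζ).im, 1 + (phase k b ζ).re]))

/-- `A = B + o(f) dθ + o(h) dρ` as the point tends to the origin, that is, for `ρ → -∞`. -/
def AsympForms (A B : ℂ → ℂ → Matrix (Fin 2) (Fin 2) ℝ) (f h : ℂ → ℝ) : Prop :=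
  ∃ P Q : ℂ → Matrix (Fin 2) (Fin 2) ℝ,
    (∀ᶠ ζ in 𝓝[≠] (0 : ℂ), ∀ ξ : ℂ, A ζ ξ = B ζ ξ + dTheta ζ ξ • P ζ + dRho ζ ξ • Q ζ) ∧
    (∀ i j, (fun ζ => P ζ i j) =o[𝓝[≠] 0] f) ∧ ∀ i j, (fun ζ => Q ζ i j) =o[𝓝[≠] 0] h

end SpecialKahler

end

noncomputable section

namespace SpecialKahler

open VectorField SpecialKahlerOn
open scoped ComplexConjugate

/-! ### Maximum principle, gradient estimate and Phragmén–Lindelöf principle in the plane. -/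

section Laplacian

/-! In a holomorphic coordinate the structure reduces to one scalar elliptic equation.
Torsion-freeness and the special condition force `∇_ξ v = P ξ v + A ξ̄ v̄` for constant fields
(`christoffel_eq`). Parallelism of the symplectic form gives `P = ∂_z log w` (`metric_deriv`),
flatness gives `2 ∂_z̄ P = -2 |A|²`, and the cubic form is `Ξ₀ = -(i/2) w Ā`. So the connection is
known once `w` and its first derivatives are, and `Δ log w = -4 |A|²` with `|A| = 2 |Ξ₀| / w`; this
is `special_kahler_in_coordinate`.

Put `ζ = e^(x+iy)`, so that `x = ρ` and `y = θ`. The relevant coefficients become `P ζ` and `A ζ̄`,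
the gradient of `log w` is `(2 Re (P ζ), -2 Im (P ζ))`, and its Laplacian is `-4 |A ζ̄|²` with `|A
ζ̄| = 2 |G| r^(n+1) / w`, where `Ξ₀ = z^n G` (`log_pullback`, `PuncturedData`). The hypothesis on
`w` controls `A` at once; what remains is to pass from asymptotics of `log w` to asymptotics of its
gradient. The interior gradient estimate for the Poisson equation
(`abs_deriv_le_of_laplacian_bound`) does this, given a bound on the Laplacian.

Conical case: `v = log w - β x` converges to `log C` and its Laplacian decays exponentially. On a
half cylinder the convergence is then itself exponential (`exp_decay_of_laplacian_decay`), and the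
gradient estimate on unit squares gives exponential decay of `P ζ - β/2`.

Logarithmic case: `v = log w - k x - log (-x)` converges, and `x² Δv` tends to `1 - 16 |c|² / C²`
with `c = G(0)`. A convergent function cannot have Laplacian asymptotic to a nonzero multiple of
`1/x²` (`eq_zero_of_laplacian_asymptotic`), so `C = 4 |c|` and `Δv = o(1/x²)`. The gradient estimate
on squares of size comparable to `|x|` yields `∇v = o(1/x)`. The relation `C = 4 |c|` also makes `b
= 4 i c / C` a unit complex number. -/

/-- The function `h` is differentiable near `t` and `A` is its second derivative at `t`. -/
def HasSecondDeriv (h : ℝ → ℝ) (A t : ℝ) : Prop :=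
  ∃ f : ℝ → ℝ, (∀ᶠ s in 𝓝 t, HasDerivAt h (f s) s) ∧ HasDerivAt f A t

namespace HasSecondDeriv

variable {h k : ℝ → ℝ} {A B t : ℝ}

lemma add (h1 : HasSecondDeriv h A t) (h2 : HasSecondDeriv k B t) :
    HasSecondDeriv (fun s => h s + k s) (A + B) t := by
  obtain ⟨f, hf, hf'⟩ := h1
  obtain ⟨g, hg, hg'⟩ := h2
  exact ⟨fun s => f s + g s, by filter_upwards [hf, hg] with s a b using a.add b, hf'.add hg'⟩

lemma const_mul (c : ℝ) (h1 : HasSecondDeriv h A t) :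
    HasSecondDeriv (fun s => c * h s) (c * A) t := by
  obtain ⟨f, hf, hf'⟩ := h1
  exact ⟨fun s => c * f s, by filter_upwards [hf] with s a using a.const_mul c, hf'.const_mul c⟩

lemma const (c t : ℝ) : HasSecondDeriv (fun _ => c) 0 t :=
  ⟨fun _ => 0, .of_forall fun s => hasDerivAt_const s c, hasDerivAt_const t 0⟩

lemma comp_const_add (c : ℝ) (h1 : HasSecondDeriv h A (c + t)) :
    HasSecondDeriv (fun s => h (c + s)) A t := by
  obtain ⟨f, hf, hf'⟩ := h1
  refine ⟨fun s => f (c + s), ?_, hf'.comp_const_add c t⟩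
  have : Tendsto (fun s => c + s) (𝓝 t) (𝓝 (c + t)) := (continuous_const_add c).tendsto t
  filter_upwards [this.eventually hf] with s hs using hs.comp_const_add c s

lemma comp_const_sub (c : ℝ) (h1 : HasSecondDeriv h A (c - t)) :
    HasSecondDeriv (fun s => h (c - s)) A t := by
  obtain ⟨f, hf, hf'⟩ := h1
  refine ⟨fun s => -f (c - s), ?_, by simpa using (hf'.comp_const_sub c t).fun_neg⟩
  have : Tendsto (fun s => c - s) (𝓝 t) (𝓝 (c - t)) := (continuous_sub_left c).tendsto t
  filter_upwards [this.eventually hf] with s hs using hs.comp_const_sub c s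

/-- The second derivative is nonpositive at a local maximum. -/
lemma nonpos_of_isLocalMax (h1 : HasSecondDeriv h A t) (hm : IsLocalMax h t) : A ≤ 0 := by
  by_contra! hA
  obtain ⟨f, hf, hf'⟩ := h1
  have hd : deriv h =ᶠ[𝓝 t] f := by filter_upwards [hf] with s hs using hs.deriv
  -- A positive second derivative would make the maximum a local minimum as well, so `h` would be
  -- locally constant and its second derivative zero.
  have hmin : IsLocalMin h t := by
    refine isLocalMin_of_deriv_deriv_pos ?_ hm.deriv_eq_zero hf.self_of_nhds.continuousAt
    rw [hd.deriv_eq, hf'.deriv]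
    exact hA
  have hc : h =ᶠ[𝓝 t] fun _ => h t := by
    filter_upwards [hm, hmin] with s h1 h2 using le_antisymm h1 h2
  have hf0 : f =ᶠ[𝓝 t] fun _ => 0 := by
    filter_upwards [hf, hc.eventuallyEq_nhds] with s hs hcs
    rw [← hs.deriv, hcs.deriv_eq, deriv_const]
  rw [hf'.unique ((hasDerivAt_const t (0 : ℝ)).congr_of_eventuallyEq hf0)] at hA
  exact lt_irrefl _ hA

end HasSecondDeriv

/-- The function `u` is continuous at `(x, y)` and `L` is its Laplacian there. -/
def HasLaplacian (u : ℝ → ℝ → ℝ) (L x y : ℝ) : Prop :=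
  ContinuousAt (Function.uncurry u) (x, y) ∧ ∃ A B, HasSecondDeriv (fun s => u s y) A x ∧
    HasSecondDeriv (fun s => u x s) B y ∧ A + B = L

namespace HasLaplacian

variable {u v : ℝ → ℝ → ℝ} {L K x y : ℝ}

lemma add (h1 : HasLaplacian u L x y) (h2 : HasLaplacian v K x y) :
    HasLaplacian (fun x y => u x y + v x y) (L + K) x y := by
  obtain ⟨c, A, B, hA, hB, rfl⟩ := h1
  obtain ⟨c', A', B', hA', hB', rfl⟩ := h2
  exact ⟨c.add c', A + A', B + B', hA.add hA', hB.add hB', by ring⟩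

lemma const_mul (c : ℝ) (h1 : HasLaplacian u L x y) :
    HasLaplacian (fun x y => c * u x y) (c * L) x y := by
  obtain ⟨hc, A, B, hA, hB, rfl⟩ := h1
  exact ⟨continuousAt_const.mul hc, c * A, c * B, hA.const_mul c, hB.const_mul c, by ring⟩

lemma neg (h1 : HasLaplacian u L x y) : HasLaplacian (fun x y => -u x y) (-L) x y := by
  simpa using h1.const_mul (-1)

lemma sub (h1 : HasLaplacian u L x y) (h2 : HasLaplacian v K x y) :
    HasLaplacian (fun x y => u x y - v x y) (L - K) x y := by
  simpa [sub_eq_add_neg] using h1.add h2.neg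

lemma swap (h1 : HasLaplacian u L x y) : HasLaplacian (fun x y => u y x) L y x := by
  obtain ⟨hc, A, B, hA, hB, rfl⟩ := h1
  refine ⟨?_, B, A, hB, hA, add_comm _ _⟩
  exact ContinuousAt.comp (f := Prod.swap) (x := (y, x)) hc continuous_swap.continuousAt

lemma translate (a b : ℝ) (h1 : HasLaplacian u L (a + x) (b + y)) :
    HasLaplacian (fun x y => u (a + x) (b + y)) L x y := by
  obtain ⟨hc, A, B, hA, hB, rfl⟩ := h1
  refine ⟨?_, A, B, hA.comp_const_add a, hB.comp_const_add b, rfl⟩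
  exact ContinuousAt.comp (g := Function.uncurry u) (f := fun q : ℝ × ℝ => (a + q.1, b + q.2))
    (x := (x, y)) hc (by fun_prop)

lemma reflect (a b : ℝ) (h1 : HasLaplacian u L (a + x) (b - y)) :
    HasLaplacian (fun x y => u (a + x) (b - y)) L x y := by
  obtain ⟨hc, A, B, hA, hB, rfl⟩ := h1
  refine ⟨?_, A, B, hA.comp_const_add a, hB.comp_const_sub b, rfl⟩
  exact ContinuousAt.comp (g := Function.uncurry u) (f := fun q : ℝ × ℝ => (a + q.1, b - q.2))
    (x := (x, y)) hc (by fun_prop)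

/-- The Laplacian of an explicit function, from its iterated partial derivatives. -/
lemma of_derivs {f g : ℝ → ℝ} {A B : ℝ} (hc : ContinuousAt (Function.uncurry u) (x, y))
    (hf : ∀ᶠ s in 𝓝 x, HasDerivAt (fun s => u s y) (f s) s) (hA : HasDerivAt f A x)
    (hg : ∀ᶠ s in 𝓝 y, HasDerivAt (fun s => u x s) (g s) s) (hB : HasDerivAt g B y) :
    HasLaplacian u (A + B) x y :=
  ⟨hc, A, B, ⟨f, hf, hA⟩, ⟨g, hg, hB⟩, rfl⟩

end HasLaplacian

lemma hasSecondDeriv_quadratic (a b c t : ℝ) :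
    HasSecondDeriv (fun s => a + b * s + c * s ^ 2) (2 * c) t := by
  refine ⟨fun s => b + 2 * c * s, .of_forall fun s => ?_, ?_⟩
  · have := (((hasDerivAt_id' s).const_mul b).const_add a).fun_add
      ((hasDerivAt_pow 2 s).const_mul c)
    refine this.congr_deriv ?_
    norm_num
    ring
  · simpa using ((hasDerivAt_id' t).const_mul (2 * c)).const_add b

/-- The Laplacian of a quadratic polynomial without mixed term. -/
lemma hasLaplacian_quadratic (a b c d e x y : ℝ) :
    HasLaplacian (fun x y => a + b * x + c * y + d * x ^ 2 + e * y ^ 2) (2 * d + 2 * e) x y := by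
  refine ⟨by unfold Function.uncurry; fun_prop, 2 * d, 2 * e, ?_, ?_, rfl⟩
  · convert hasSecondDeriv_quadratic (a + c * y + e * y ^ 2) b d x using 2
    ring
  · convert hasSecondDeriv_quadratic (a + b * x + d * x ^ 2) c e y using 2
    ring

/-- The weak maximum principle on a rectangle. -/
theorem nonpos_of_boundary {u : ℝ → ℝ → ℝ} {a b c d : ℝ}
    (hl : ∀ x ∈ Icc a b, ∀ y ∈ Icc c d, ∃ L, 0 ≤ L ∧ HasLaplacian u L x y)
    (hb : ∀ x ∈ Icc a b, ∀ y ∈ Icc c d, (x = a ∨ x = b ∨ y = c ∨ y = d) → u x y ≤ 0)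
    {x y : ℝ} (hx : x ∈ Icc a b) (hy : y ∈ Icc c d) : u x y ≤ 0 := by
  have key : ∀ ε > 0, u x y ≤ ε * (b - a) ^ 2 := by
    intro ε hε
    -- The added term `ε ((x - a)² - (b - a)²)` is nonpositive on the rectangle and raises the
    -- Laplacian by `2 ε`, which makes it strictly positive and excludes an interior maximum.
    set v : ℝ → ℝ → ℝ := fun x y => u x y +
      (ε * a ^ 2 - ε * (b - a) ^ 2 + -2 * ε * a * x + 0 * y + ε * x ^ 2 + 0 * y ^ 2) with hv
    have hve (x y : ℝ) : v x y = u x y + ε * ((x - a) ^ 2 - (b - a) ^ 2) := by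
      rw [hv]
      ring
    have hvl : ∀ x ∈ Icc a b, ∀ y ∈ Icc c d, ∃ L, 0 < L ∧ HasLaplacian v L x y := by
      intro x hx y hy
      obtain ⟨L, hL, h⟩ := hl x hx y hy
      exact ⟨_, by positivity, h.add (hasLaplacian_quadratic _ _ _ ε 0 x y)⟩
    have hcont : ContinuousOn (Function.uncurry v) (Icc a b ×ˢ Icc c d) := by
      rintro ⟨x, y⟩ ⟨hx, hy⟩
      obtain ⟨L, -, h⟩ := hvl x hx y hy
      exact h.1.continuousWithinAt
    obtain ⟨⟨x0, y0⟩, ⟨hx0, hy0⟩, hmax⟩ :=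
      (isCompact_Icc.prod isCompact_Icc).exists_isMaxOn ⟨(x, y), hx, hy⟩ hcont
    have hsq : ∀ x ∈ Icc a b, (x - a) ^ 2 ≤ (b - a) ^ 2 := fun x hx => by
      have := hx.1
      have := hx.2
      gcongr
    have hxy : v x y ≤ v x0 y0 := hmax (show (x, y) ∈ Icc a b ×ˢ Icc c d from ⟨hx, hy⟩)
    have h0 : v x0 y0 ≤ 0 := by
      by_cases hbd : x0 = a ∨ x0 = b ∨ y0 = c ∨ y0 = d
      · have h1 := hb x0 hx0 y0 hy0 hbd
        have h2 := hsq x0 hx0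
        rw [hve]
        nlinarith
      · push Not at hbd
        obtain ⟨n1, n2, n3, n4⟩ := hbd
        obtain ⟨L, hL, -, A, B, hA, hB, rfl⟩ := hvl x0 hx0 y0 hy0
        have hX : Icc a b ∈ 𝓝 x0 :=
          Icc_mem_nhds (lt_of_le_of_ne hx0.1 (Ne.symm n1)) (lt_of_le_of_ne hx0.2 n2)
        have hY : Icc c d ∈ 𝓝 y0 :=
          Icc_mem_nhds (lt_of_le_of_ne hy0.1 (Ne.symm n3)) (lt_of_le_of_ne hy0.2 n4)
        have hA0 := hA.nonpos_of_isLocalMax (by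
          filter_upwards [hX] with s hs
          exact hmax (show (s, y0) ∈ Icc a b ×ˢ Icc c d from ⟨hs, hy0⟩))
        have hB0 := hB.nonpos_of_isLocalMax (by
          filter_upwards [hY] with s hs
          exact hmax (show (x0, s) ∈ Icc a b ×ˢ Icc c d from ⟨hx0, hs⟩))
        linarith
    have h1 := hxy.trans h0
    rw [hve] at h1
    nlinarith [sq_nonneg (x - a)]
  refine le_of_forall_pos_le_add fun η hη => ?_
  have h := key (η / ((b - a) ^ 2 + 1)) (by positivity)
  have h2 : η / ((b - a) ^ 2 + 1) * (b - a) ^ 2 ≤ η := by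
    rw [div_mul_eq_mul_div, div_le_iff₀ (by positivity)]
    nlinarith
  linarith

/-- The odd part `φ` of `u` in `y` about `y₀` vanishes on the axis and has derivative `D` there. On
`[-d, d] × [0, d]` it is compared with a barrier of Laplacian `-N` that is nonnegative on the axis
and at least `m` on the other three sides; the slope of the barrier in `y` at the origin is the
asserted bound. -/
lemma deriv_le_of_laplacian_bound {u : ℝ → ℝ → ℝ} {x₀ y₀ d c m N D : ℝ} (hd : 0 < d)
    (hN : 0 ≤ N) (hu : ∀ x y, |x - x₀| ≤ d → |y - y₀| ≤ d →
      |u x y - c| ≤ m ∧ ∃ L, |L| ≤ N ∧ HasLaplacian u L x y)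
    (hD : HasDerivAt (fun y => u x₀ y) D y₀) : D ≤ 2 * m / d + N * d / 2 := by
  have hm : 0 ≤ m := (abs_nonneg _).trans (hu x₀ y₀ (by simp [hd.le]) (by simp [hd.le])).1
  set φ : ℝ → ℝ → ℝ := fun x y => (1 / 2) * (u (x₀ + x) (y₀ + y) - u (x₀ + x) (y₀ - y)) with hφ
  have hcmp : ∀ t ∈ Icc 0 d, φ 0 t ≤ t * (2 * m / d + N * d / 2) := by
    intro t ht
    have h := nonpos_of_boundary (a := -d) (b := d) (c := 0) (d := d) (x := 0) (y := t)
      (u := fun x y => φ x y - (0 + 0 * x + (2 * m / d + N * d / 2) * y + (m / d ^ 2) * x ^ 2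
        + (-(m / d ^ 2) - N / 2) * y ^ 2)) ?_ ?_ ⟨by linarith, hd.le⟩ ht
    · have h2 : 0 ≤ (m / d ^ 2 + N / 2) * t ^ 2 := by positivity
      nlinarith
    · intro x hx y hy
      obtain ⟨-, L1, hL1, h1⟩ := hu (x₀ + x) (y₀ + y)
        (by simpa using abs_le.2 hx) (by simpa using abs_le.2 ⟨by linarith [hy.1], hy.2⟩)
      obtain ⟨-, L2, hL2, h2⟩ := hu (x₀ + x) (y₀ - y)
        (by simpa using abs_le.2 hx) (by simpa using abs_le.2 ⟨by linarith [hy.1], hy.2⟩)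
      refine ⟨_, ?_, (((h1.translate _ _).sub (h2.reflect _ _)).const_mul (1 / 2)).sub
        (hasLaplacian_quadratic _ _ _ _ _ x y)⟩
      have := abs_le.1 hL1
      have := abs_le.1 hL2
      linarith
    · intro x hx y hy hbd
      have b1 := abs_le.1 (hu (x₀ + x) (y₀ + y)
        (by simpa using abs_le.2 hx) (by simpa using abs_le.2 ⟨by linarith [hy.1], hy.2⟩)).1
      have b2 := abs_le.1 (hu (x₀ + x) (y₀ - y)
        (by simpa using abs_le.2 hx) (by simpa using abs_le.2 ⟨by linarith [hy.1], hy.2⟩)).1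
      -- This form of the barrier shows its size on the sides: the bracket multiplying `m` is at
      -- least 1 when `|x| = d` or `y = d`.
      have e : 0 + 0 * x + (2 * m / d + N * d / 2) * y + (m / d ^ 2) * x ^ 2
        + (-(m / d ^ 2) - N / 2) * y ^ 2
          = m * ((x / d) ^ 2 + (y / d) * (2 - y / d)) + N / 2 * (y * (d - y)) := by
        field_simp
        ring
      have hy1 : y / d ≤ 1 := (div_le_one hd).2 hy.2
      have hy0 : 0 ≤ y / d := div_nonneg hy.1 hd.le
      have hyd : 0 ≤ N / 2 * (y * (d - y)) :=
        mul_nonneg (by linarith) (mul_nonneg hy.1 (by linarith [hy.2]))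
      have hφm : φ x y ≤ m := by
        simp only [hφ]
        linarith
      rw [e]
      rcases hbd with rfl | rfl | rfl | rfl
      · have : (-d / d) ^ 2 = 1 := by field_simp
        rw [this]
        nlinarith [mul_nonneg hm (mul_nonneg hy0 (by linarith : 0 ≤ 2 - y / d))]
      · have : (x / x) ^ 2 = 1 := by field_simp
        rw [this]
        nlinarith [mul_nonneg hm (mul_nonneg hy0 (by linarith : 0 ≤ 2 - y / x))]
      · simp only [hφ]
        simp
        positivity
      · have : y / y = 1 := by field_simp
        rw [this]
        nlinarith [mul_nonneg hm (sq_nonneg (x / y))]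
  have hφ' : HasDerivAt (fun t => φ 0 t) D 0 := by
    have h1 : HasDerivAt (fun t => u x₀ (y₀ + t)) D 0 := by
      refine HasDerivAt.comp_const_add y₀ 0 ?_
      simpa using hD
    have h2 : HasDerivAt (fun t => u x₀ (y₀ - t)) (-D) 0 := by
      refine HasDerivAt.comp_const_sub y₀ 0 ?_
      simpa using hD
    simp only [hφ, add_zero]
    refine ((h1.fun_sub h2).const_mul (1 / 2)).congr_deriv ?_
    ring
  refine le_of_tendsto hφ'.tendsto_slope_zero_right ?_
  filter_upwards [Ioc_mem_nhdsGT hd] with t ht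
  have h0 : φ 0 0 = 0 := by simp [hφ]
  rw [h0, zero_add, sub_zero, smul_eq_mul, inv_mul_le_iff₀ ht.1]
  exact hcmp t ⟨ht.1.le, ht.2⟩

/-- The interior gradient estimate for the Poisson equation, in the second variable. -/
theorem abs_deriv_le_of_laplacian_bound {u : ℝ → ℝ → ℝ} {x₀ y₀ d c m N D : ℝ} (hd : 0 < d)
    (hN : 0 ≤ N) (hu : ∀ x y, |x - x₀| ≤ d → |y - y₀| ≤ d →
      |u x y - c| ≤ m ∧ ∃ L, |L| ≤ N ∧ HasLaplacian u L x y)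
    (hD : HasDerivAt (fun y => u x₀ y) D y₀) : |D| ≤ 2 * m / d + N * d / 2 := by
  refine abs_le'.2 ⟨deriv_le_of_laplacian_bound hd hN hu hD, ?_⟩
  refine deriv_le_of_laplacian_bound (u := fun x y => -u x y) (c := -c) hd hN ?_ hD.neg
  intro x y hx hy
  obtain ⟨h1, L, hL, h2⟩ := hu x y hx hy
  refine ⟨?_, -L, by rwa [abs_neg], h2.neg⟩
  rwa [neg_sub_neg, abs_sub_comm]

/-- The interior gradient estimate for the Poisson equation, in the first variable. -/
theorem abs_deriv_le_of_laplacian_bound' {u : ℝ → ℝ → ℝ} {x₀ y₀ d c m N D : ℝ} (hd : 0 < d)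
    (hN : 0 ≤ N) (hu : ∀ x y, |x - x₀| ≤ d → |y - y₀| ≤ d →
      |u x y - c| ≤ m ∧ ∃ L, |L| ≤ N ∧ HasLaplacian u L x y)
    (hD : HasDerivAt (fun x => u x y₀) D x₀) : |D| ≤ 2 * m / d + N * d / 2 := by
  refine abs_deriv_le_of_laplacian_bound (u := fun x y => u y x) (x₀ := y₀) (c := c) hd hN ?_ hD
  intro x y hx hy
  obtain ⟨h1, L, hL, h2⟩ := hu y x hy hx
  exact ⟨h1, L, hL, h2.swap⟩

/-- A Phragmén–Lindelöf principle: a subharmonic function of sublinear growth on a half plane is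
bounded by its values on the boundary. -/
theorem le_of_subharmonic_halfPlane {P : ℝ → ℝ → ℝ} {X A : ℝ}
    (hl : ∀ x ≤ X, ∀ y, ∃ L, 0 ≤ L ∧ HasLaplacian P L x y) (hA : ∀ y, P X y ≤ A)
    (hg : ∀ ε > 0, ∃ K, ∀ x ≤ X, ∀ y, P x y ≤ K + ε * (X - x)) {x₀ : ℝ} (hx₀ : x₀ ≤ X) (y₀ : ℝ) :
    P x₀ y₀ ≤ A := by
  have key : ∀ ε > 0, P x₀ y₀ ≤ A + ε * (X - x₀) := by
    intro ε hε
    obtain ⟨K, hK⟩ := hg ε hε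
    set H := max (K - A) 0 with hH
    have hH0 : 0 ≤ H := le_max_right _ _
    have hHK : K ≤ A + H := by linarith [le_max_left (K - A) 0]
    have hR : ∀ R : ℝ, 0 < R → X - x₀ ≤ R →
        P x₀ y₀ ≤ A + ε * (X - x₀) + 2 * H * (X - x₀) * R⁻¹ := by
      intro R hR0 hR
      -- With `t = (X - x)/R` the majorant is harmonic, since the second derivatives of `((y -
      -- y₀)/R)²` and `t (1 - t)` cancel. It is at least `A` on the line `x = X` and, as `A + H ≥
      -- K`, at least `K + ε (X - x)` on the other three sides. Its excess over `A + ε (X - x₀)` at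
      -- `(x₀, y₀)` is `O(1/R)`.
      have e (x y : ℝ) : (A + (H / R + ε) * X + H / R ^ 2 * (y₀ ^ 2 + X * (R - X)))
          + (-(H / R + ε) + H / R ^ 2 * (2 * X - R)) * x + (-2 * H / R ^ 2 * y₀) * y
          + (-(H / R ^ 2)) * x ^ 2 + (H / R ^ 2) * y ^ 2
          = A + H * ((X - x) / R) + ε * (X - x)
            + H * (((y - y₀) / R) ^ 2 + (X - x) / R * (1 - (X - x) / R)) := by
        field_simp
        ring
      have h := nonpos_of_boundary (a := X - R) (b := X) (c := y₀ - R) (d := y₀ + R)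
        (x := x₀) (y := y₀)
        (u := fun x y => P x y - ((A + (H / R + ε) * X + H / R ^ 2 * (y₀ ^ 2 + X * (R - X)))
          + (-(H / R + ε) + H / R ^ 2 * (2 * X - R)) * x + (-2 * H / R ^ 2 * y₀) * y
          + (-(H / R ^ 2)) * x ^ 2 + (H / R ^ 2) * y ^ 2)) ?_ ?_ ⟨by linarith, hx₀⟩
          ⟨by linarith, by linarith⟩
      · simp only [e] at h
        have h2 : (X - x₀) / R = (X - x₀) * R⁻¹ := div_eq_mul_inv _ _
        have h3 : 0 ≤ (X - x₀) / R := div_nonneg (by linarith) hR0.le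
        rw [sub_self, zero_div] at h
        have h4 : H * (0 ^ 2 + (X - x₀) / R * (1 - (X - x₀) / R)) ≤ H * ((X - x₀) / R) := by
          apply mul_le_mul_of_nonneg_left _ hH0
          nlinarith
        rw [mul_assoc (2 * H), ← h2]
        linarith
      · intro x hx y _
        obtain ⟨L, hL, h⟩ := hl x hx.2 y
        refine ⟨_, ?_, h.sub (hasLaplacian_quadratic _ _ _ _ _ x y)⟩
        linarith
      · intro x hx y hy hbd
        simp only [e]
        have t0 : 0 ≤ (X - x) / R := div_nonneg (by linarith [hx.2]) hR0.le
        have t1 : (X - x) / R ≤ 1 := (div_le_one hR0).2 (by linarith [hx.1])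
        have hq : 0 ≤ H * ((X - x) / R * (1 - (X - x) / R)) :=
          mul_nonneg hH0 (mul_nonneg t0 (by linarith))
        have hs : 0 ≤ H * ((y - y₀) / R) ^ 2 := by positivity
        have hHt : 0 ≤ H * ((X - x) / R) := mul_nonneg hH0 t0
        have hPK := hK x hx.2 y
        rw [mul_add]
        rcases hbd with h1 | h1 | h1 | h1
        · have : (X - x) / R = 1 := by
            rw [h1]
            field_simp
            ring
          rw [this] at hq ⊢
          linarith
        · have := hA y
          rw [h1] at hPK hq hHt ⊢
          simp only [sub_self, mul_zero, zero_div] at *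
          linarith
        · have : ((y - y₀) / R) ^ 2 = 1 := by
            rw [h1]
            field_simp
            ring
          rw [this]
          linarith
        · have : ((y - y₀) / R) ^ 2 = 1 := by
            rw [h1]
            field_simp
            ring
          rw [this]
          linarith
    have hlim : Tendsto (fun R : ℝ => A + ε * (X - x₀) + 2 * H * (X - x₀) * R⁻¹) atTop
        (𝓝 (A + ε * (X - x₀) + 2 * H * (X - x₀) * 0)) :=
      (tendsto_inv_atTop_zero.const_mul _).const_add _
    rw [mul_zero, add_zero] at hlim
    refine ge_of_tendsto hlim ?_
    filter_upwards [eventually_gt_atTop 0, eventually_ge_atTop (X - x₀)] with R h1 h2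
    exact hR R h1 h2
  refine le_of_forall_pos_le_add fun η hη => ?_
  have h0 : 0 ≤ X - x₀ := by linarith
  have h := key (η / (X - x₀ + 1)) (by positivity)
  have h2 : η / (X - x₀ + 1) * (X - x₀) ≤ η := by
    rw [div_mul_eq_mul_div, div_le_iff₀ (by positivity)]
    nlinarith
  linarith

end Laplacian

/-! ### Functions with prescribed Laplacian decay on half planes and half cylinders. -/

section HalfPlane

/-- The Laplacian of a function of the first variable only. -/
lemma hasLaplacian_fst {h f : ℝ → ℝ} {A x : ℝ} (hf : ∀ᶠ s in 𝓝 x, HasDerivAt h (f s) s)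
    (hA : HasDerivAt f A x) (y : ℝ) : HasLaplacian (fun x _ => h x) A x y := by
  refine ⟨?_, A, 0, ⟨f, hf, hA⟩, HasSecondDeriv.const _ _, add_zero A⟩
  exact ContinuousAt.comp (f := Prod.fst) (x := (x, y)) hf.self_of_nhds.continuousAt
    continuous_fst.continuousAt

lemma hasLaplacian_log_neg {x : ℝ} (hx : x < 0) (y : ℝ) :
    HasLaplacian (fun x _ => Real.log (-x)) (-(x ^ 2)⁻¹) x y := by
  refine hasLaplacian_fst (f := fun s => s⁻¹) ?_ (hasDerivAt_inv hx.ne) y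
  filter_upwards [Iio_mem_nhds hx] with s hs
  have := (hasDerivAt_neg s).log (neg_ne_zero.2 (ne_of_lt hs))
  refine this.congr_deriv ?_
  rw [neg_div_neg_eq, one_div]

lemma hasLaplacian_exp (c γ x y : ℝ) :
    HasLaplacian (fun x _ => c * Real.exp (γ * x)) (c * (γ ^ 2 * Real.exp (γ * x))) x y := by
  refine HasLaplacian.const_mul c (hasLaplacian_fst (f := fun s => γ * Real.exp (γ * s))
    (.of_forall fun s => ?_) ?_ y)
  · refine ((hasDerivAt_id' s).const_mul γ).exp.congr_deriv ?_
    ring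
  · refine (((hasDerivAt_id' x).const_mul γ).exp.const_mul γ).congr_deriv ?_
    ring

/-- For `c > 0` the function `v + (c/2) log (-x)` is subharmonic far to the left, because `log (-x)`
has Laplacian `-1/x²`. It grows sublinearly, so the half plane principle bounds it, although it
tends to `+∞`. -/
lemma not_pos_of_laplacian_asymptotic {v F : ℝ → ℝ → ℝ} {ℓ c X : ℝ}
    (hl : ∀ x < X, ∀ y, HasLaplacian v (F x y) x y)
    (hF : ∀ ε > 0, ∃ R, ∀ x < R, ∀ y, |x ^ 2 * F x y - c| ≤ ε)
    (hv : ∀ ε > 0, ∃ R, ∀ x < R, ∀ y, |v x y - ℓ| ≤ ε) : ¬ 0 < c := by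
  intro hc
  obtain ⟨R1, h1⟩ := hF (c / 2) (by positivity)
  obtain ⟨R2, h2⟩ := hv 1 one_pos
  obtain ⟨ρ, hρ⟩ := exists_lt (min (min R1 R2) (min X (-1)))
  simp only [lt_min_iff] at hρ
  obtain ⟨⟨hρ1, hρ2⟩, hρX, hρ0⟩ := hρ
  have hbound : ∀ x ≤ ρ, ∀ y, v x y + c / 2 * Real.log (-x) ≤ ℓ + 1 + c / 2 * Real.log (-ρ) := by
    intro x hx y
    refine le_of_subharmonic_halfPlane (P := fun x y => v x y + c / 2 * Real.log (-x)) (X := ρ)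
      ?_ ?_ ?_ hx y
    · intro x hx y
      have hx0 : x < 0 := by linarith
      refine ⟨_, ?_, (hl x (by linarith) y).add ((hasLaplacian_log_neg hx0 y).const_mul (c / 2))⟩
      have h3 := (abs_le.1 (h1 x (by linarith) y)).1
      have hxn := hx0.ne
      have hx2 : 0 < x ^ 2 := by positivity
      have : F x y + c / 2 * -(x ^ 2)⁻¹ = (x ^ 2 * F x y - c / 2) / x ^ 2 := by
        field_simp
        ring
      rw [this]
      exact div_nonneg (by linarith) hx2.le
    · intro y
      have := (abs_le.1 (h2 ρ hρ2 y)).2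
      linarith
    · intro ε hε
      set δ := 2 * ε / c with hδ
      have hδ0 : 0 < δ := by positivity
      refine ⟨ℓ + 1 + c / 2 * (δ * (-ρ) - 1 - Real.log δ), fun x hx y => ?_⟩
      have h3 := (abs_le.1 (h2 x (by linarith) y)).2
      have hx0 : 0 < -x := by linarith
      have h4 := Real.log_le_sub_one_of_pos (mul_pos hδ0 hx0)
      rw [Real.log_mul hδ0.ne' hx0.ne'] at h4
      have h5 : c / 2 * Real.log (-x) ≤ c / 2 * (δ * -x - 1 - Real.log δ) := by
        gcongr
        linarith
      have h6 : c / 2 * (δ * -x - 1 - Real.log δ)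
          = c / 2 * (δ * (-ρ) - 1 - Real.log δ) + ε * (ρ - x) := by
        rw [hδ]
        field_simp
        ring
      linarith
  -- Once `log (-x) ≥ B`, the term `4/c` absorbs the two unit errors in `v` and the final `1` leaves
  -- a strict excess `c/2` over the bound.
  set B := Real.log (-ρ) + 4 / c + 1 with hB
  have hx : min ρ (-Real.exp B) ≤ ρ := min_le_left _ _
  have h3 := hbound _ hx 0
  have h4 := (abs_le.1 (h2 (min ρ (-Real.exp B)) (by linarith) 0)).1
  have h5 : B ≤ Real.log (-min ρ (-Real.exp B)) := by
    rw [Real.le_log_iff_exp_le (by linarith)]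
    linarith [min_le_right ρ (-Real.exp B)]
  have h6 : c / 2 * B ≤ c / 2 * Real.log (-min ρ (-Real.exp B)) := by gcongr
  have h7 : c / 2 * B = c / 2 * Real.log (-ρ) + 2 + c / 2 := by
    rw [hB]
    field_simp
    ring
  linarith

/-- A convergent function on a half plane cannot have Laplacian asymptotic to `c / x²`, `c ≠ 0`. -/
theorem eq_zero_of_laplacian_asymptotic {v F : ℝ → ℝ → ℝ} {ℓ c X : ℝ}
    (hl : ∀ x < X, ∀ y, HasLaplacian v (F x y) x y)
    (hF : ∀ ε > 0, ∃ R, ∀ x < R, ∀ y, |x ^ 2 * F x y - c| ≤ ε)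
    (hv : ∀ ε > 0, ∃ R, ∀ x < R, ∀ y, |v x y - ℓ| ≤ ε) : c = 0 := by
  refine le_antisymm (not_lt.1 (not_pos_of_laplacian_asymptotic hl hF hv)) ?_
  have := not_pos_of_laplacian_asymptotic (v := fun x y => -v x y) (F := fun x y => -F x y)
    (ℓ := -ℓ) (c := -c) (fun x hx y => (hl x hx y).neg) ?_ ?_
  · linarith
  · intro ε hε
    obtain ⟨R, hR⟩ := hF ε hε
    refine ⟨R, fun x hx y => ?_⟩
    rw [mul_neg, neg_sub_neg, abs_sub_comm]
    exact hR x hx y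
  · intro ε hε
    obtain ⟨R, hR⟩ := hv ε hε
    refine ⟨R, fun x hx y => ?_⟩
    rw [neg_sub_neg, abs_sub_comm]
    exact hR x hx y

/-- The barrier `T e^(γ x) (1 + y (π - y))`. -/
lemma hasLaplacian_barrier (T γ x y : ℝ) :
    HasLaplacian (fun x y => T * Real.exp (γ * x) * (1 + y * (Real.pi - y)))
      (T * Real.exp (γ * x) * (γ ^ 2 * (1 + y * (Real.pi - y)) - 2)) x y := by
  refine ⟨by unfold Function.uncurry; fun_prop,
    (1 + y * (Real.pi - y)) * (T * (γ ^ 2 * Real.exp (γ * x))),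
    2 * (-(T * Real.exp (γ * x))), ?_, ?_, by ring⟩
  · have h : HasSecondDeriv (fun s => T * Real.exp (γ * s)) (T * (γ ^ 2 * Real.exp (γ * x))) x := by
      refine ⟨fun s => T * (γ * Real.exp (γ * s)), .of_forall fun s => ?_, ?_⟩
      · refine (((hasDerivAt_id' s).const_mul γ).exp.const_mul T).congr_deriv ?_
        ring
      · refine ((((hasDerivAt_id' x).const_mul γ).exp.const_mul γ).const_mul T).congr_deriv ?_
        ring
    convert h.const_mul (1 + y * (Real.pi - y)) using 2
    ring
  · convert hasSecondDeriv_quadratic (T * Real.exp (γ * x)) (T * Real.exp (γ * x) * Real.pi)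
      (-(T * Real.exp (γ * x))) y using 2
    ring

/-- On a half cylinder, the oscillation on circles of a convergent function with exponentially
decaying Laplacian decays exponentially. -/
lemma circle_oscillation_decay {v F : ℝ → ℝ → ℝ} {ℓ K γ ρ : ℝ} (hγ : 0 < γ) (hγ' : γ ≤ 1 / 2)
    (hK : 0 ≤ K) (hper : ∀ x y, v x (y + 2 * Real.pi) = v x y)
    (hl : ∀ x ≤ ρ, ∀ y, HasLaplacian v (F x y) x y)
    (hF : ∀ x ≤ ρ, ∀ y, |F x y| ≤ K * Real.exp (γ * x))
    (hv1 : ∀ x ≤ ρ, ∀ y, |v x y - ℓ| ≤ 1)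
    (hv : ∀ ε > 0, ∃ R, ∀ x < R, ∀ y, |v x y - ℓ| ≤ ε) :
    ∃ T, 0 ≤ T ∧ ∀ x ≤ ρ, ∀ y y', v x y - v x y' ≤ T * Real.exp (γ * x) := by
  -- The first summand lets the barrier absorb the Laplacians of two values of `v`; the second makes
  -- the barrier at least 2 on the edge `x = ρ`, where two values of `v` differ by at most 2.
  set T := 2 * K + 2 * Real.exp (-(γ * ρ)) with hT
  have hT0 : 0 ≤ T := by positivity
  have hTρ : 2 ≤ T * Real.exp (γ * ρ) := by
    have h1 : Real.exp (-(γ * ρ)) * Real.exp (γ * ρ) = 1 := by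
      rw [← Real.exp_add, neg_add_cancel, Real.exp_zero]
    have h2 : 0 ≤ K * Real.exp (γ * ρ) := by positivity
    rw [hT]
    nlinarith
  have hπ : ∀ y : ℝ, y * (Real.pi - y) ≤ 5 / 2 := by
    intro y
    nlinarith [sq_nonneg (y - Real.pi / 2), Real.pi_lt_d2, Real.pi_pos]
  -- The difference of `v` and its reflection in the line `y = θ` vanishes at `y = 0` and, by
  -- periodicity, at `y = π`. This permits a barrier on a strip.
  have key : ∀ x ≤ ρ, ∀ θ, ∀ y ∈ Icc 0 Real.pi,
      v x (θ + y) - v x (θ - y) ≤ 4 * T * Real.exp (γ * x) := by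
    intro x hx θ y hy
    -- The slack `ε` covers a left edge `x = a` chosen so far away that `v` is already close to its
    -- limit.
    have hε : ∀ ε > 0, v x (θ + y) - v x (θ - y)
        ≤ T * Real.exp (γ * x) * (1 + y * (Real.pi - y)) + ε := by
      intro ε hε
      obtain ⟨R, hR⟩ := hv (ε / 2) (by positivity)
      obtain ⟨a, ha⟩ := exists_lt (min R x)
      rw [lt_min_iff] at ha
      have h := nonpos_of_boundary (a := a) (b := ρ) (c := 0) (d := Real.pi) (x := x) (y := y)
        (u := fun x y => v (0 + x) (θ + y) - v (0 + x) (θ - y)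
          - T * Real.exp (γ * x) * (1 + y * (Real.pi - y))
          - (ε + 0 * x + 0 * y + 0 * x ^ 2 + 0 * y ^ 2)) ?_ ?_ ⟨ha.2.le, hx⟩ hy
      · simp only [zero_add, zero_mul, add_zero] at h
        linarith
      · intro x hx y hy
        have h1 := hl (0 + x) (by linarith [hx.2]) (θ + y)
        have h2 := hl (0 + x) (by linarith [hx.2]) (θ - y)
        refine ⟨_, ?_, ((h1.translate 0 θ).sub (h2.reflect 0 θ)).sub
          (hasLaplacian_barrier T γ x y) |>.sub (hasLaplacian_quadratic ε 0 0 0 0 x y)⟩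
        have b1 := (abs_le.1 (hF (0 + x) (by linarith [hx.2]) (θ + y))).1
        have b2 := (abs_le.1 (hF (0 + x) (by linarith [hx.2]) (θ - y))).2
        simp only [zero_add] at b1 b2 ⊢
        have hTe : 2 * K * Real.exp (γ * x) ≤ T * Real.exp (γ * x) := by
          gcongr
          rw [hT]
          have := Real.exp_pos (-(γ * ρ))
          linarith
        -- Here `γ ≤ 1/2` is needed: `γ² (1 + 5/2) ≤ 7/8`.
        have hb : γ ^ 2 * (1 + y * (Real.pi - y)) - 2 ≤ -1 := by
          have h0 : 0 ≤ y * (Real.pi - y) := mul_nonneg hy.1 (by linarith [hy.2])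
          have : γ ^ 2 ≤ 1 / 4 := by nlinarith
          nlinarith [hπ y]
        have hTb : T * Real.exp (γ * x) * (γ ^ 2 * (1 + y * (Real.pi - y)) - 2)
            ≤ T * Real.exp (γ * x) * (-1) := mul_le_mul_of_nonneg_left hb (by positivity)
        linarith
      · intro x hx y hy hbd
        have hp : 0 ≤ T * Real.exp (γ * x) * (y * (Real.pi - y)) :=
          mul_nonneg (by positivity) (mul_nonneg hy.1 (by linarith [hy.2]))
        have hp0 : 0 ≤ T * Real.exp (γ * x) := by positivity
        simp only [zero_add, zero_mul, add_zero, mul_add, mul_one]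
        rcases hbd with h1 | h1 | h1 | h1
        · rw [h1] at hp hp0 ⊢
          have b1 := (abs_le.1 (hR a ha.1 (θ + y))).2
          have b2 := (abs_le.1 (hR a ha.1 (θ - y))).1
          linarith
        · rw [h1] at hp hp0 ⊢
          have b1 := (abs_le.1 (hv1 ρ le_rfl (θ + y))).2
          have b2 := (abs_le.1 (hv1 ρ le_rfl (θ - y))).1
          linarith
        · rw [h1] at hp ⊢
          rw [add_zero, sub_zero, sub_self]
          linarith
        · have : v x (θ + y) = v x (θ - y) := by
            rw [h1, ← hper x (θ - Real.pi)]
            congr 1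
            ring
          rw [this]
          linarith
    have h1 := le_of_forall_pos_le_add hε
    refine h1.trans ?_
    have := hπ y
    have h2 : T * Real.exp (γ * x) * (1 + y * (Real.pi - y)) ≤ T * Real.exp (γ * x) * 4 :=
      mul_le_mul_of_nonneg_left (by linarith) (by positivity)
    linarith
  refine ⟨4 * T, by positivity, fun x hx y y' => ?_⟩
  have hP : Function.Periodic (v x) (2 * Real.pi) := hper x
  -- After reducing `y` to `[y', y' + 2π)`, the two points are symmetric about their midpoint, with
  -- half distance in `[0, π]`.
  have hmem := toIcoMod_mem_Ico Real.two_pi_pos y' y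
  have hval : v x (toIcoMod Real.two_pi_pos y' y) = v x y := hP.sub_zsmul_eq _
  set t := toIcoMod Real.two_pi_pos y' y
  have h := key x hx ((t + y') / 2) ((t - y') / 2)
    ⟨by linarith [hmem.1], by linarith [hmem.2]⟩
  rw [← hval]
  convert h using 3 <;> ring

/-- The function `v + (K/γ²) e^(γx)` is bounded and subharmonic, so to the left of the line through
`(x, y)` it is bounded by its values on that line, which the oscillation bound compares with `v x
y`. Letting the first variable tend to `-∞` replaces `v` by its limit `ℓ`. The opposite inequality
follows from `-v`. -/
lemma limit_sub_le_exp {v F : ℝ → ℝ → ℝ} {ℓ K γ ρ T : ℝ} (hγ : 0 < γ) (hK : 0 ≤ K)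
    (hl : ∀ x ≤ ρ, ∀ y, HasLaplacian v (F x y) x y)
    (hF : ∀ x ≤ ρ, ∀ y, |F x y| ≤ K * Real.exp (γ * x))
    (hv1 : ∀ x ≤ ρ, ∀ y, |v x y - ℓ| ≤ 1)
    (hv : ∀ ε > 0, ∃ R, ∀ x < R, ∀ y, |v x y - ℓ| ≤ ε)
    (hT : ∀ x ≤ ρ, ∀ y y', v x y - v x y' ≤ T * Real.exp (γ * x)) :
    ∀ x ≤ ρ, ∀ y, ℓ - v x y ≤ (T + K / γ ^ 2) * Real.exp (γ * x) := by
  intro ρ' hρ' y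
  set c := K / γ ^ 2 with hc
  have hc0 : 0 ≤ c := by positivity
  have hcK : c * γ ^ 2 = K := by
    rw [hc]
    field_simp
  have hb : ∀ x ≤ ρ', ∀ y', v x y' + c * Real.exp (γ * x)
      ≤ v ρ' y + T * Real.exp (γ * ρ') + c * Real.exp (γ * ρ') := by
    intro x hx y'
    refine le_of_subharmonic_halfPlane (P := fun x y => v x y + c * Real.exp (γ * x)) (X := ρ')
      ?_ ?_ ?_ hx y'
    · intro x hx y
      refine ⟨_, ?_, (hl x (hx.trans hρ') y).add (hasLaplacian_exp c γ x y)⟩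
      have := (abs_le.1 (hF x (hx.trans hρ') y)).1
      rw [← mul_assoc, hcK]
      linarith
    · intro y'
      have := hT ρ' hρ' y' y
      linarith
    · intro ε hε
      refine ⟨ℓ + 1 + c * Real.exp (γ * ρ'), fun x hx y => ?_⟩
      have h1 := (abs_le.1 (hv1 x (hx.trans hρ') y)).2
      have h2 : c * Real.exp (γ * x) ≤ c * Real.exp (γ * ρ') := by gcongr
      have h3 : 0 ≤ ε * (ρ' - x) := mul_nonneg hε.le (by linarith)
      linarith
  refine le_of_forall_pos_le_add fun ε hε => ?_
  obtain ⟨R, hR⟩ := hv ε hε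
  obtain ⟨a, ha⟩ := exists_lt (min R ρ')
  rw [lt_min_iff] at ha
  have h1 := hb a ha.2.le 0
  have h2 := (abs_le.1 (hR a ha.1 0)).1
  have h3 : 0 ≤ c * Real.exp (γ * a) := by positivity
  linarith

/-- On a half cylinder, a convergent function with exponentially decaying Laplacian converges
exponentially fast. -/
theorem exp_decay_of_laplacian_decay {v F : ℝ → ℝ → ℝ} {ℓ K γ X : ℝ} (hγ : 0 < γ)
    (hγ' : γ ≤ 1 / 2) (hK : 0 ≤ K) (hper : ∀ x y, v x (y + 2 * Real.pi) = v x y)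
    (hl : ∀ x < X, ∀ y, HasLaplacian v (F x y) x y)
    (hF : ∀ x < X, ∀ y, |F x y| ≤ K * Real.exp (γ * x))
    (hv : ∀ ε > 0, ∃ R, ∀ x < R, ∀ y, |v x y - ℓ| ≤ ε) :
    ∃ C ρ, 0 ≤ C ∧ ∀ x ≤ ρ, ∀ y, |v x y - ℓ| ≤ C * Real.exp (γ * x) := by
  obtain ⟨R, hR⟩ := hv 1 one_pos
  obtain ⟨ρ, hρ⟩ := exists_lt (min R X)
  rw [lt_min_iff] at hρ
  have hl' : ∀ x ≤ ρ, ∀ y, HasLaplacian v (F x y) x y := fun x hx y => hl x (by linarith) y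
  have hF' : ∀ x ≤ ρ, ∀ y, |F x y| ≤ K * Real.exp (γ * x) := fun x hx y => hF x (by linarith) y
  have hv1 : ∀ x ≤ ρ, ∀ y, |v x y - ℓ| ≤ 1 := fun x hx y => hR x (by linarith) y
  obtain ⟨T, hT0, hT⟩ := circle_oscillation_decay hγ hγ' hK hper hl' hF' hv1 hv
  have h1 := limit_sub_le_exp hγ hK hl' hF' hv1 hv hT
  have h2 := limit_sub_le_exp (v := fun x y => -v x y) (F := fun x y => -F x y) (ℓ := -ℓ)
    (T := T) hγ hK
    (fun x hx y => (hl' x hx y).neg) (fun x hx y => by rw [abs_neg]; exact hF' x hx y)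
    (fun x hx y => by rw [neg_sub_neg, abs_sub_comm]; exact hv1 x hx y)
    (fun ε hε => by
      obtain ⟨R, hR⟩ := hv ε hε
      exact ⟨R, fun x hx y => by rw [neg_sub_neg, abs_sub_comm]; exact hR x hx y⟩)
    (fun x hx y y' => by rw [neg_sub_neg]; exact hT x hx y' y)
  refine ⟨T + K / γ ^ 2, ρ, by positivity, fun x hx y => abs_le.2 ⟨?_, ?_⟩⟩
  · linarith [h1 x hx y]
  · linarith [h2 x hx y]

end HalfPlane

/-! ### The punctured disc in logarithmic coordinates. -/

section LogarithmicCoordinates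

/-- The covering `(x, y) ↦ e^(x + i y)` of the punctured plane. -/
def polarExp (x y : ℝ) : ℂ := Complex.exp (x + y * Complex.I)

lemma norm_polarExp (x y : ℝ) : ‖polarExp x y‖ = Real.exp x := by
  simp [polarExp, Complex.norm_exp]

lemma rho_polarExp (x y : ℝ) : rho (polarExp x y) = x := by
  rw [rho, norm_polarExp, Real.log_exp]

lemma polarExp_ne_zero (x y : ℝ) : polarExp x y ≠ 0 := Complex.exp_ne_zero _

lemma polarExp_periodic (x y : ℝ) : polarExp x (y + 2 * Real.pi) = polarExp x y := by
  rw [polarExp, polarExp, ← Complex.exp_periodic (x + y * Complex.I)]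
  congr 1
  push_cast
  ring

/-- Neighbourhoods of the puncture are half planes in logarithmic coordinates. -/
lemma eventually_punctured_iff {p : ℂ → Prop} :
    (∀ᶠ ζ in 𝓝[≠] 0, p ζ) ↔ ∃ X, ∀ x < X, ∀ y, p (polarExp x y) := by
  constructor
  · intro h
    rw [eventually_nhdsWithin_iff, Metric.eventually_nhds_iff] at h
    obtain ⟨r, hr, h⟩ := h
    refine ⟨Real.log r, fun x hx y => h ?_ (polarExp_ne_zero x y)⟩
    rw [dist_zero_right, norm_polarExp]
    exact (Real.lt_log_iff_exp_lt hr).1 hx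
  · rintro ⟨X, h⟩
    rw [eventually_nhdsWithin_iff, Metric.eventually_nhds_iff]
    refine ⟨Real.exp X, Real.exp_pos X, fun ζ hζ hζ0 => ?_⟩
    rw [dist_zero_right] at hζ
    have hlog := h (Real.log ‖ζ‖) ((Real.log_lt_iff_lt_exp (norm_pos_iff.2 hζ0)).2 hζ)
      (Complex.arg ζ)
    have e : polarExp (Real.log ‖ζ‖) (Complex.arg ζ) = ζ := Complex.exp_log hζ0
    rwa [e] at hlog

lemma hasDerivAt_polarExp_fst (x y : ℝ) :
    HasDerivAt (fun s => polarExp s y) (polarExp x y) x := by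
  have h : HasDerivAt (fun s : ℝ => (s : ℂ) + y * Complex.I) 1 x :=
    (Complex.ofRealCLM.hasDerivAt (x := x)).add_const _
  simpa [polarExp] using! h.cexp

lemma hasDerivAt_polarExp_snd (x y : ℝ) :
    HasDerivAt (fun s => polarExp x s) (Complex.I * polarExp x y) y := by
  have h : HasDerivAt (fun s : ℝ => (x : ℂ) + s * Complex.I) (1 * Complex.I) y :=
    ((Complex.ofRealCLM.hasDerivAt (x := y)).mul_const _).const_add _
  have h2 := h.cexp
  rw [one_mul, mul_comm] at h2
  exact h2

/-- If `d log w (ξ) = 2 Re (P ξ)` and `∂_x P + i ∂_y P = -2 |A|²`, then in logarithmic coordinates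
the derivatives of `log w` are given by `P ζ` and its Laplacian is `-4 |A ζ|²`. -/
lemma log_pullback {w : ℂ → ℝ} {P A : ℂ → ℂ} {X : ℝ}
    (hw : ∀ x < X, ∀ y, 0 < w (polarExp x y))
    (hd : ∀ x < X, ∀ y, ∃ L : ℂ →L[ℝ] ℝ, HasFDerivAt w L (polarExp x y) ∧
      ∀ ξ, L ξ = 2 * w (polarExp x y) * (P (polarExp x y) * ξ).re)
    (hP : ∀ x < X, ∀ y, ∃ L : ℂ →L[ℝ] ℂ, HasFDerivAt P L (polarExp x y) ∧
      L 1 + Complex.I * L Complex.I = -2 * (‖A (polarExp x y)‖ : ℂ) ^ 2)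
    {x : ℝ} (hx : x < X) (y : ℝ) :
    HasDerivAt (fun s => Real.log (w (polarExp s y))) (2 * (P (polarExp x y) * polarExp x y).re) x ∧
    HasDerivAt (fun s => Real.log (w (polarExp x s)))
      (-2 * (P (polarExp x y) * polarExp x y).im) y ∧
    HasLaplacian (fun x y => Real.log (w (polarExp x y)))
      (-4 * ‖A (polarExp x y) * conj (polarExp x y)‖ ^ 2) x y := by
  have h1 : ∀ x < X, ∀ y, HasDerivAt (fun s => Real.log (w (polarExp s y)))
      (2 * (P (polarExp x y) * polarExp x y).re) x := by
    intro x hx y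
    obtain ⟨L, hL, e⟩ := hd x hx y
    have := (hL.comp_hasDerivAt x (hasDerivAt_polarExp_fst x y)).log (hw x hx y).ne'
    refine this.congr_deriv ?_
    rw [e]
    have := (hw x hx y).ne'
    simp only [Function.comp]
    field_simp
  have h2 : ∀ x < X, ∀ y, HasDerivAt (fun s => Real.log (w (polarExp x s)))
      (-2 * (P (polarExp x y) * polarExp x y).im) y := by
    intro x hx y
    obtain ⟨L, hL, e⟩ := hd x hx y
    have := (hL.comp_hasDerivAt y (hasDerivAt_polarExp_snd x y)).log (hw x hx y).ne'
    refine this.congr_deriv ?_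
    rw [e]
    have := (hw x hx y).ne'
    simp only [Function.comp]
    field_simp
    simp
    ring
  refine ⟨h1 x hx y, h2 x hx y, ?_⟩
  obtain ⟨L, hL, -⟩ := hd x hx y
  obtain ⟨D, hD, e⟩ := hP x hx y
  have hc : ContinuousAt (Function.uncurry fun x y => Real.log (w (polarExp x y))) (x, y) := by
    have he : ContinuousAt (fun q : ℝ × ℝ => polarExp q.1 q.2) (x, y) := by
      unfold polarExp
      fun_prop
    exact (ContinuousAt.comp (x := (x, y)) (f := fun q : ℝ × ℝ => polarExp q.1 q.2) (g := w)
      hL.continuousAt he).log (hw x hx y).ne'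
  -- The Laplacian is `2 Re ((∂_x + i ∂_y)(P ζ))`. The factor `ζ` is holomorphic in `x + i y`, and
  -- the chain rule gives `(∂_x + i ∂_y) P = ζ̄ (D 1 + i D i)`.
  have hA := (Complex.reCLM.hasFDerivAt.comp_hasDerivAt x
    ((hD.comp_hasDerivAt x (hasDerivAt_polarExp_fst x y)).mul
      (hasDerivAt_polarExp_fst x y))).const_mul 2
  have hB := (Complex.imCLM.hasFDerivAt.comp_hasDerivAt y
    ((hD.comp_hasDerivAt y (hasDerivAt_polarExp_snd x y)).mul
      (hasDerivAt_polarExp_snd x y))).const_mul (-2)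
  have key := HasLaplacian.of_derivs (u := fun x y => Real.log (w (polarExp x y))) hc
    (by filter_upwards [Iio_mem_nhds hx] with s hs using h1 s hs y) hA
    (.of_forall fun s => h2 x hx s) hB
  convert key using 1
  have hlin (ξ : ℂ) : D ξ = ξ.re * D 1 + ξ.im * D Complex.I := by
    have : ξ = ξ.re • (1 : ℂ) + ξ.im • Complex.I := by simp [Complex.re_add_im]
    conv_lhs => rw [this]
    rw [map_add, map_smul, map_smul, Complex.real_smul, Complex.real_smul]
  rw [hlin (polarExp x y), hlin (Complex.I * polarExp x y)]
  have e1 : D 1 = -2 * (‖A (polarExp x y)‖ : ℂ) ^ 2 - Complex.I * D Complex.I := by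
    rw [← e]
    ring
  rw [e1, norm_mul, RCLike.norm_conj, mul_pow, ← Complex.normSq_eq_norm_sq (polarExp x y),
    Complex.normSq_apply]
  simp [← Complex.ofReal_pow]
  ring

end LogarithmicCoordinates

/-! ### Asymptotics of the local data at the puncture. -/

section PuncturedDisc

/-- The local data of an affine special Kähler structure `g = w |dz|²`, `ω_∇(ξ) v = P ξ v + A ξ̄ v̄`
on a punctured disc, whose cubic form is `z^n G(z) dz³` with `G → c ≠ 0`. -/
structure PuncturedData (w : ℂ → ℝ) (P A G : ℂ → ℂ) (n : ℤ) (c : ℂ) : Prop where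
  pos : ∀ᶠ ζ in 𝓝[≠] 0, 0 < w ζ
  deriv : ∀ᶠ ζ in 𝓝[≠] 0, ∃ L : ℂ →L[ℝ] ℝ, HasFDerivAt w L ζ ∧ ∀ ξ, L ξ = 2 * w ζ * (P ζ * ξ).re
  curvature : ∀ᶠ ζ in 𝓝[≠] 0, ∃ L : ℂ →L[ℝ] ℂ, HasFDerivAt P L ζ ∧
    L 1 + Complex.I * L Complex.I = -2 * (‖A ζ‖ : ℂ) ^ 2
  cubic : ∀ᶠ ζ in 𝓝[≠] 0, ζ ^ n * G ζ = -(Complex.I / 2) * w ζ * conj (A ζ)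
  tendsto : Tendsto G (𝓝[≠] 0) (𝓝 c)
  ne_zero : c ≠ 0

namespace PuncturedData

variable {w : ℂ → ℝ} {P A G : ℂ → ℂ} {n : ℤ} {c : ℂ} (h : PuncturedData w P A G n c)

include h

/-- The cubic form determines `A` algebraically from `w`, so asymptotics of `A` need no derivative
estimate. -/
lemma conj_eq : ∀ᶠ ζ in 𝓝[≠] 0,
    conj (A ζ * conj ζ) = 2 * Complex.I * (ζ ^ (n + 1) * G ζ) / w ζ := by
  filter_upwards [h.pos, h.cubic, self_mem_nhdsWithin] with ζ h1 h2 h3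
  have hw : (w ζ : ℂ) ≠ 0 := by exact_mod_cast h1.ne'
  have e : ζ ^ (n + 1) * G ζ = ζ * (-(Complex.I / 2) * w ζ * conj (A ζ)) := by
    rw [zpow_add_one₀ h3, ← h2]
    ring
  rw [e, map_mul, Complex.conj_conj, eq_div_iff hw]
  linear_combination (conj (A ζ) * ζ * w ζ) * Complex.I_sq

lemma norm_anti_eq : ∀ᶠ ζ in 𝓝[≠] 0, ‖A ζ * conj ζ‖ = 2 * ‖G ζ‖ * (‖ζ‖ ^ (n + 1) / w ζ) := by
  filter_upwards [h.pos, h.conj_eq] with ζ h1 h2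
  rw [← RCLike.norm_conj, h2]
  simp [abs_of_pos h1]
  ring

lemma log_coordinates : ∃ X, ∀ x < X, ∀ y,
    HasDerivAt (fun s => Real.log (w (polarExp s y))) (2 * (P (polarExp x y) * polarExp x y).re) x ∧
    HasDerivAt (fun s => Real.log (w (polarExp x s)))
      (-2 * (P (polarExp x y) * polarExp x y).im) y ∧
    HasLaplacian (fun x y => Real.log (w (polarExp x y)))
      (-4 * ‖A (polarExp x y) * conj (polarExp x y)‖ ^ 2) x y := by
  obtain ⟨X, hX⟩ := eventually_punctured_iff.1 (h.pos.and (h.deriv.and h.curvature))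
  exact ⟨X, fun x hx y => log_pullback (fun x hx y => (hX x hx y).1)
    (fun x hx y => (hX x hx y).2.1) (fun x hx y => (hX x hx y).2.2) hx y⟩

/-- Below the threshold, the metric has a conical singularity and the connection form converges
exponentially fast to that of the flat cone. -/
theorem conical {β C : ℝ} (hβ : β < n + 1) (hC : 0 < C)
    (hw : Tendsto (fun ζ : ℂ => w ζ / ‖ζ‖ ^ β) (𝓝[≠] 0) (𝓝 C)) :
    ∃ γ K : ℝ, 0 < γ ∧ ∀ᶠ ζ in 𝓝[≠] 0, ‖P ζ * ζ - (β / 2 : ℝ)‖ ≤ K * Real.exp (γ * rho ζ) ∧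
      ‖A ζ * conj ζ‖ ≤ K * Real.exp (γ * rho ζ) := by
  set δ : ℝ := n + 1 - β with hδ
  have hδ0 : 0 < δ := by linarith
  -- The rate `δ` is that of `r^(n+1-β)`, which governs `A ζ̄`; the cap `1/2` is required by the
  -- barrier on the half cylinder.
  set γ := min (1 / 2) δ with hγ
  have hγ0 : 0 < γ := lt_min (by norm_num) hδ0
  have hγ1 : γ ≤ 1 / 2 := min_le_left _ _
  have hγδ : γ ≤ δ := min_le_right _ _
  set K₀ : ℝ := 4 * (‖c‖ + 1) / C with hK₀
  have hK₀0 : 0 ≤ K₀ := by positivity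
  have hsmall : ∀ᶠ ζ : ℂ in 𝓝[≠] 0, rho ζ < 0 :=
    eventually_punctured_iff.2 ⟨0, fun x hx y => by rwa [rho_polarExp]⟩
  have hA : ∀ᶠ ζ in 𝓝[≠] 0, ‖A ζ * conj ζ‖ ≤ K₀ * Real.exp (γ * rho ζ) := by
    have hG : ∀ᶠ ζ in 𝓝[≠] 0, ‖G ζ‖ < ‖c‖ + 1 :=
      h.tendsto.norm.eventually_lt_const (by linarith)
    have hwC : ∀ᶠ ζ : ℂ in 𝓝[≠] 0, C / 2 < w ζ / ‖ζ‖ ^ β :=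
      hw.eventually_const_lt (by linarith)
    filter_upwards [h.norm_anti_eq, hG, hwC, hsmall, self_mem_nhdsWithin, h.pos]
      with ζ h1 h2 h3 h4 h5 h6
    have hr : 0 < ‖ζ‖ := norm_pos_iff.2 h5
    have e1 : ‖ζ‖ ^ (n + 1) = ‖ζ‖ ^ β * ‖ζ‖ ^ δ := by
      rw [← Real.rpow_add hr, ← Real.rpow_intCast]
      congr 1
      rw [hδ]
      push_cast
      ring
    have e2 : ‖ζ‖ ^ (n + 1) / w ζ = ‖ζ‖ ^ δ / (w ζ / ‖ζ‖ ^ β) := by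
      rw [e1]
      have := (Real.rpow_pos_of_pos hr β).ne'
      field_simp
    have e3 : ‖ζ‖ ^ δ ≤ Real.exp (γ * rho ζ) := by
      rw [Real.rpow_def_of_pos hr, mul_comm]
      apply Real.exp_le_exp.2
      change δ * rho ζ ≤ γ * rho ζ
      nlinarith
    rw [h1, e2]
    calc 2 * ‖G ζ‖ * (‖ζ‖ ^ δ / (w ζ / ‖ζ‖ ^ β))
        ≤ 2 * (‖c‖ + 1) * (Real.exp (γ * rho ζ) / (C / 2)) := by gcongr
      _ = K₀ * Real.exp (γ * rho ζ) := by
        rw [hK₀]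
        field_simp
        ring
  set v : ℝ → ℝ → ℝ := fun x y =>
    Real.log (w (polarExp x y)) - (0 + β * x + 0 * y + 0 * x ^ 2 + 0 * y ^ 2) with hv
  have hvlim : ∀ ε > 0, ∃ R, ∀ x < R, ∀ y, |v x y - Real.log C| ≤ ε := by
    intro ε hε
    have h1 := (hw.log hC.ne').eventually (Metric.closedBall_mem_nhds (Real.log C) hε)
    obtain ⟨R, hR⟩ := eventually_punctured_iff.1 (h1.and h.pos)
    refine ⟨R, fun x hx y => ?_⟩
    obtain ⟨h2, h3⟩ := hR x hx y
    have hr := Real.exp_pos x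
    rw [Real.dist_eq, norm_polarExp, Real.log_div h3.ne' (Real.rpow_pos_of_pos hr β).ne',
      Real.log_rpow hr, Real.log_exp] at h2
    simpa [hv] using h2
  obtain ⟨X₁, hX₁⟩ := h.log_coordinates
  obtain ⟨X₂, hX₂⟩ := eventually_punctured_iff.1 (hA.and hsmall)
  set X := min X₁ X₂
  have hl : ∀ x < X, ∀ y,
      HasLaplacian v (-4 * ‖A (polarExp x y) * conj (polarExp x y)‖ ^ 2) x y := by
    intro x hx y
    have := (hX₁ x (hx.trans_le (min_le_left _ _)) y).2.2.sub
      (hasLaplacian_quadratic 0 β 0 0 0 x y)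
    convert this using 1
    ring
  -- The Laplacian is quadratic in `A`, hence `O(e^(2γx))`; one factor `e^(γx) ≤ 1` is dropped.
  have hF : ∀ x < X, ∀ y, |-4 * ‖A (polarExp x y) * conj (polarExp x y)‖ ^ 2|
      ≤ 4 * K₀ ^ 2 * Real.exp (γ * x) := by
    intro x hx y
    obtain ⟨h1, h2⟩ := hX₂ x (hx.trans_le (min_le_right _ _)) y
    rw [rho_polarExp] at h1 h2
    have h3 : Real.exp (γ * x) ≤ 1 := Real.exp_le_one_iff.2 (by nlinarith)
    rw [abs_mul, abs_neg, abs_of_nonneg (by positivity : (0 : ℝ) ≤ 4), abs_of_nonneg (by positivity),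
      mul_assoc]
    gcongr
    calc ‖A (polarExp x y) * conj (polarExp x y)‖ ^ 2 ≤ (K₀ * Real.exp (γ * x)) ^ 2 := by gcongr
      _ = K₀ ^ 2 * (Real.exp (γ * x) * Real.exp (γ * x)) := by ring
      _ ≤ K₀ ^ 2 * (Real.exp (γ * x) * 1) := by gcongr
      _ = K₀ ^ 2 * Real.exp (γ * x) := by ring
  obtain ⟨C₁, ρ, hC₁, hdec⟩ := exp_decay_of_laplacian_decay hγ0 hγ1 (by positivity)
    (fun x y => by simp only [hv, polarExp_periodic]; ring) hl hF hvlim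
  -- This is the constant of the gradient estimate on squares with `d = 1`; the factor `e^γ` appears
  -- because they reach `x + 1`.
  set K₁ := (2 * C₁ + 2 * K₀ ^ 2) * Real.exp γ with hK₁
  have hK₁0 : 0 ≤ K₁ := by positivity
  refine ⟨γ, max K₀ (2 * K₁), hγ0, ?_⟩
  have hP : ∀ᶠ ζ in 𝓝[≠] 0, ‖P ζ * ζ - (β / 2 : ℝ)‖ ≤ 2 * K₁ * Real.exp (γ * rho ζ) := by
    refine eventually_punctured_iff.2 ⟨min ρ X - 1, fun x hx y => ?_⟩
    have hxρ : x < ρ - 1 := by linarith [min_le_left ρ X]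
    have hxX : x < X - 1 := by linarith [min_le_right ρ X]
    obtain ⟨d1, d2, -⟩ := hX₁ x (by linarith [min_le_left X₁ X₂]) y
    have d1' : HasDerivAt (fun s => v s y) (2 * (P (polarExp x y) * polarExp x y).re - β) x := by
      have e : (fun s => v s y) = fun s => Real.log (w (polarExp s y)) - β * s := by
        funext s
        simp only [hv]
        ring
      rw [e]
      simpa using d1.fun_sub ((hasDerivAt_id' x).const_mul β)
    have d2' : HasDerivAt (fun s => v x s) (-2 * (P (polarExp x y) * polarExp x y).im) y := by
      have e : (fun s => v x s) = fun s => Real.log (w (polarExp x s)) - β * x := by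
        funext s
        simp only [hv]
        ring
      rw [e]
      exact d2.sub_const _
    have hloc : ∀ x' y', |x' - x| ≤ 1 → |y' - y| ≤ 1 →
        |v x' y' - Real.log C| ≤ C₁ * Real.exp (γ * (x + 1)) ∧
        ∃ L, |L| ≤ 4 * K₀ ^ 2 * Real.exp (γ * (x + 1)) ∧ HasLaplacian v L x' y' := by
      intro x' y' hx' _
      have hx'1 := (abs_le.1 hx').2
      have hexp : Real.exp (γ * x') ≤ Real.exp (γ * (x + 1)) :=
        Real.exp_le_exp.2 (mul_le_mul_of_nonneg_left (by linarith) hγ0.le)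
      refine ⟨(hdec x' (by linarith) y').trans (by gcongr), _,
        (hF x' (by linarith) y').trans (by gcongr), hl x' (by linarith) y'⟩
    have b1 := abs_deriv_le_of_laplacian_bound' one_pos (by positivity) hloc d1'
    have b2 := abs_deriv_le_of_laplacian_bound one_pos (by positivity) hloc d2'
    have hK : 2 * (C₁ * Real.exp (γ * (x + 1))) / 1
        + 4 * K₀ ^ 2 * Real.exp (γ * (x + 1)) * 1 / 2 = K₁ * Real.exp (γ * x) := by
      rw [hK₁, mul_add, mul_one, Real.exp_add]
      ring
    rw [hK] at b1 b2
    rw [rho_polarExp]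
    refine (Complex.norm_le_abs_re_add_abs_im _).trans ?_
    have r1 : (P (polarExp x y) * polarExp x y - (β / 2 : ℝ)).re
        = (2 * (P (polarExp x y) * polarExp x y).re - β) / 2 := by
      rw [Complex.sub_re, Complex.ofReal_re]
      ring
    have r2 : (P (polarExp x y) * polarExp x y - (β / 2 : ℝ)).im
        = -(-2 * (P (polarExp x y) * polarExp x y).im) / 2 := by
      rw [Complex.sub_im, Complex.ofReal_im]
      ring
    rw [r1, r2, abs_div, abs_div, abs_neg, abs_of_pos (two_pos : (0 : ℝ) < 2)]
    have : 0 ≤ K₁ * Real.exp (γ * x) := by positivity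
    linarith
  filter_upwards [hA, hP] with ζ h1 h2
  refine ⟨h2.trans ?_, h1.trans ?_⟩
  · gcongr
    exact le_max_right _ _
  · gcongr
    exact le_max_left _ _

/-- At the threshold, the metric has a logarithmic singularity. -/
theorem logarithmic {C : ℝ} (hC : 0 < C)
    (hw : Tendsto (fun ζ : ℂ => w ζ / (-(‖ζ‖ ^ (n + 1) * Real.log ‖ζ‖))) (𝓝[≠] 0) (𝓝 C)) :
    C = 4 * ‖c‖ ∧
    Tendsto (fun ζ => rho ζ * ‖P ζ * ζ - (((n + 1) / 2 + (rho ζ)⁻¹ / 2 : ℝ) : ℂ)‖) (𝓝[≠] 0) (𝓝 0) ∧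
    Tendsto (fun ζ => rho ζ *
      ‖A ζ * conj ζ + (rho ζ)⁻¹ / 2 * conj (phase (n + 1) (4 * Complex.I * c / C) ζ)‖)
      (𝓝[≠] 0) (𝓝 0) := by
  have hsmall : ∀ᶠ ζ : ℂ in 𝓝[≠] 0, rho ζ < 0 :=
    eventually_punctured_iff.2 ⟨0, fun x hx y => by rwa [rho_polarExp]⟩
  have hratio : Tendsto (fun ζ : ℂ => rho ζ * (‖ζ‖ ^ (n + 1) / w ζ)) (𝓝[≠] 0) (𝓝 (-C⁻¹)) := by
    refine (hw.inv₀ hC.ne').neg.congr' ?_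
    filter_upwards [h.pos] with ζ h1
    rw [rho, inv_div]
    ring
  have hAlim : Tendsto (fun ζ => rho ζ * ‖A ζ * conj ζ‖) (𝓝[≠] 0) (𝓝 (2 * ‖c‖ * -C⁻¹)) := by
    refine ((h.tendsto.norm.const_mul 2).mul hratio).congr' ?_
    filter_upwards [h.norm_anti_eq] with ζ h1
    rw [h1]
    ring
  set k : ℝ := n + 1 with hk
  set v : ℝ → ℝ → ℝ := fun x y =>
    Real.log (w (polarExp x y)) - (0 + k * x + 0 * y + 0 * x ^ 2 + 0 * y ^ 2) - Real.log (-x)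
    with hv
  have hvlim : ∀ ε > 0, ∃ R, ∀ x < R, ∀ y, |v x y - Real.log C| ≤ ε := by
    intro ε hε
    have h1 := (hw.log hC.ne').eventually (Metric.closedBall_mem_nhds (Real.log C) hε)
    obtain ⟨R, hR⟩ := eventually_punctured_iff.1 (h1.and (h.pos.and hsmall))
    refine ⟨R, fun x hx y => ?_⟩
    obtain ⟨h2, h3, h4⟩ := hR x hx y
    rw [rho_polarExp] at h4
    have hr := zpow_pos (Real.exp_pos x) (n + 1)
    rw [Real.dist_eq, norm_polarExp, Real.log_exp, ← mul_neg,
      Real.log_div h3.ne' (mul_pos hr (neg_pos.2 h4)).ne', Real.log_mul hr.ne' (neg_pos.2 h4).ne',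
      Real.log_zpow, Real.log_exp] at h2
    have e : v x y = Real.log (w (polarExp x y)) - (((n + 1 : ℤ) : ℝ) * x + Real.log (-x)) := by
      rw [hv, hk]
      push_cast
      ring
    rwa [e]
  obtain ⟨X₁, hX₁⟩ := h.log_coordinates
  set X := min X₁ 0
  set F : ℝ → ℝ → ℝ := fun x y =>
    -4 * ‖A (polarExp x y) * conj (polarExp x y)‖ ^ 2 + (x ^ 2)⁻¹ with hF
  have hl : ∀ x < X, ∀ y, HasLaplacian v (F x y) x y := by
    intro x hx y
    have := ((hX₁ x (hx.trans_le (min_le_left _ _)) y).2.2.sub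
      (hasLaplacian_quadratic 0 k 0 0 0 x y)).sub
      (hasLaplacian_log_neg (hx.trans_le (min_le_right _ _)) y)
    convert this using 1
    rw [hF]
    ring
  have hFlim : ∀ ε > 0, ∃ R, ∀ x < R, ∀ y,
      |x ^ 2 * F x y - (1 - 4 * (2 * ‖c‖ * -C⁻¹) ^ 2)| ≤ ε := by
    intro ε hε
    have h1 := (((hAlim.pow 2).const_mul 4).const_sub 1).eventually
      (Metric.closedBall_mem_nhds _ hε)
    obtain ⟨R, hR⟩ := eventually_punctured_iff.1 (h1.and hsmall)
    refine ⟨R, fun x hx y => ?_⟩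
    obtain ⟨h2, h3⟩ := hR x hx y
    rw [rho_polarExp] at h2 h3
    rw [Real.dist_eq] at h2
    convert h2 using 3
    have := h3.ne
    rw [hF]
    field_simp
    ring
  -- Convergence of `v` forces the coefficient of `1/x²` to vanish, and this fixes `C` in terms of
  -- `c`.
  have hzero := eq_zero_of_laplacian_asymptotic hl hFlim hvlim
  have hCc : C = 4 * ‖c‖ := by
    have h1 : (C - 4 * ‖c‖) * (C + 4 * ‖c‖) = 0 := by
      field_simp at hzero
      linarith
    rcases mul_eq_zero.1 h1 with h2 | h2
    · linarith
    · linarith [norm_nonneg c]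
  rw [hzero] at hFlim
  refine ⟨hCc, ?_, ?_⟩
  · rw [Metric.tendsto_nhds]
    intro η hη
    set ε := η / 20 with hε
    have hε0 : 0 < ε := by positivity
    obtain ⟨R₁, hR₁⟩ := hvlim ε hε0
    obtain ⟨R₂, hR₂⟩ := hFlim ε hε0
    obtain ⟨R, hR⟩ := exists_lt (min (min R₁ R₂) (min X (-1)))
    simp only [lt_min_iff] at hR
    obtain ⟨⟨r1, r2⟩, r3, r4⟩ := hR
    -- For `x < 2 R` the square of half side `|x|/2` about `(x, y)` lies in `x' ≤ x/2 < R`. There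
    -- `x'² ≥ x²/4`, so the Laplacian is at most `4 ε / x²`, and the gradient estimate gives `5 ε /
    -- |x|`.
    refine eventually_punctured_iff.2 ⟨2 * R, fun x hx y => ?_⟩
    have hx0 : x < 0 := by linarith
    have hxX : x < X := by linarith
    obtain ⟨d1, d2, -⟩ := hX₁ x (hxX.trans_le (min_le_left _ _)) y
    have d1' : HasDerivAt (fun s => v s y)
        (2 * (P (polarExp x y) * polarExp x y).re - k - x⁻¹) x := by
      have e : (fun s => v s y)
          = fun s => Real.log (w (polarExp s y)) - k * s - Real.log (-s) := by
        funext s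
        simp only [hv]
        ring
      rw [e]
      have dl : HasDerivAt (fun s => Real.log (-s)) x⁻¹ x := by
        refine ((hasDerivAt_neg x).log (neg_ne_zero.2 hx0.ne)).congr_deriv ?_
        rw [neg_div_neg_eq, one_div]
      simpa using (d1.fun_sub ((hasDerivAt_id' x).const_mul k)).fun_sub dl
    have d2' : HasDerivAt (fun s => v x s) (-2 * (P (polarExp x y) * polarExp x y).im) y := by
      have e : (fun s => v x s)
          = fun s => Real.log (w (polarExp x s)) - k * x - Real.log (-x) := by
        funext s
        simp only [hv]
        ring
      rw [e]
      exact (d2.sub_const _).sub_const _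
    have hd : 0 < -x / 2 := by linarith
    have hloc : ∀ x' y', |x' - x| ≤ -x / 2 → |y' - y| ≤ -x / 2 →
        |v x' y' - Real.log C| ≤ ε ∧ ∃ L, |L| ≤ 4 * ε / x ^ 2 ∧ HasLaplacian v L x' y' := by
      intro x' y' hx' _
      have hx'1 := (abs_le.1 hx').2
      have hx'R : x' < R := by linarith
      refine ⟨hR₁ x' (by linarith) y', _, ?_, hl x' (by linarith) y'⟩
      have h1 := hR₂ x' (by linarith) y'
      rw [sub_zero, abs_mul, abs_of_nonneg (sq_nonneg x')] at h1
      have hsq : x ^ 2 / 4 ≤ x' ^ 2 := by nlinarith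
      have hxn := hx0.ne
      rw [le_div_iff₀ (by positivity)]
      nlinarith [abs_nonneg (F x' y')]
    have b1 := abs_deriv_le_of_laplacian_bound' hd (by positivity) hloc d1'
    have b2 := abs_deriv_le_of_laplacian_bound hd (by positivity) hloc d2'
    have hK : 2 * ε / (-x / 2) + 4 * ε / x ^ 2 * (-x / 2) / 2 = 5 * ε / -x := by
      have := hx0.ne
      field_simp
      ring
    rw [hK] at b1 b2
    rw [rho_polarExp, dist_zero_right, norm_mul, norm_norm, Real.norm_eq_abs, abs_of_neg hx0]
    have hn : ‖P (polarExp x y) * polarExp x y - ((k / 2 + x⁻¹ / 2 : ℝ) : ℂ)‖ ≤ 5 * ε / -x := by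
      refine (Complex.norm_le_abs_re_add_abs_im _).trans ?_
      have e1 : (P (polarExp x y) * polarExp x y - ((k / 2 + x⁻¹ / 2 : ℝ) : ℂ)).re
          = (2 * (P (polarExp x y) * polarExp x y).re - k - x⁻¹) / 2 := by
        rw [Complex.sub_re, Complex.ofReal_re]
        ring
      have e2 : (P (polarExp x y) * polarExp x y - ((k / 2 + x⁻¹ / 2 : ℝ) : ℂ)).im
          = -(-2 * (P (polarExp x y) * polarExp x y).im) / 2 := by
        rw [Complex.sub_im, Complex.ofReal_im]
        ring
      rw [e1, e2, abs_div, abs_div, abs_neg, abs_of_pos (two_pos : (0 : ℝ) < 2)]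
      linarith
    calc -x * ‖P (polarExp x y) * polarExp x y - ((k / 2 + x⁻¹ / 2 : ℝ) : ℂ)‖
        ≤ -x * (5 * ε / -x) := mul_le_mul_of_nonneg_left hn (by linarith)
      _ = 5 * ε := mul_div_cancel₀ _ (by linarith)
      _ < η := by rw [hε]; linarith
  · have hCne : (C : ℂ) ≠ 0 := by exact_mod_cast hC.ne'
    -- Up to the unimodular factor `(ζ/|ζ|)^(n+1)`, this is the conjugate of `ρ` times the error in
    -- `A ζ̄`; that factor is restored through `hu`.
    have hlim : Tendsto (fun ζ => 2 * Complex.I * G ζ * ((rho ζ * (‖ζ‖ ^ (n + 1) / w ζ) : ℝ) : ℂ)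
        + 2 * Complex.I * c / C) (𝓝[≠] 0) (𝓝 0) := by
      have := ((h.tendsto.const_mul (2 * Complex.I)).mul
        ((Complex.continuous_ofReal.tendsto _).comp hratio)).add_const (2 * Complex.I * c / C)
      have e : 2 * Complex.I * c * ((-C⁻¹ : ℝ) : ℂ) + 2 * Complex.I * c / C = 0 := by
        push_cast
        field_simp
        ring
      rw [e] at this
      exact this
    rw [tendsto_zero_iff_norm_tendsto_zero] at hlim ⊢
    refine hlim.congr' ?_
    filter_upwards [h.conj_eq, hsmall, self_mem_nhdsWithin] with ζ h1 h2 h3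
    have hnz : (‖ζ‖ : ℂ) ≠ 0 := by exact_mod_cast (norm_pos_iff.2 h3).ne'
    have hρ : (rho ζ : ℂ) ≠ 0 := by exact_mod_cast h2.ne
    rw [norm_mul, norm_norm, ← RCLike.norm_conj (A ζ * conj ζ + _), ← Complex.norm_real (rho ζ),
      ← norm_mul, map_add, h1]
    have hu : ‖(ζ / (‖ζ‖ : ℂ)) ^ (n + 1)‖ = 1 := by
      rw [norm_zpow, norm_div, Complex.norm_real, norm_norm, div_self (norm_pos_iff.2 h3).ne',
        one_zpow]
    rw [← one_mul ‖2 * Complex.I * G ζ * _ + _‖, ← hu, ← norm_mul]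
    congr 1
    rw [phase, map_mul, Complex.conj_conj, map_div₀, Complex.conj_ofReal]
    simp only [map_ofNat]
    rw [div_zpow]
    have := zpow_ne_zero (n + 1) hnz
    push_cast
    field_simp
    ring

end PuncturedData

end PuncturedDisc

/-! ### Holomorphic coordinates and their coordinate vector fields. -/

section Chart

variable {M : Type*} [TopologicalSpace M] [ChartedSpace ℂ M]

lemma mem_maximalAtlas_real [IsManifold 𝓘(ℂ, ℂ) ω M] {z : OpenPartialHomeomorph M ℂ}
    (hz : z ∈ IsManifold.maximalAtlas 𝓘(ℂ, ℂ) ω M) :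
    z ∈ IsManifold.maximalAtlas 𝓘(ℝ, ℂ) ω M := by
  rw [IsManifold.maximalAtlas, mem_maximalAtlas_iff] at hz ⊢
  intro e he
  obtain ⟨h1, h2⟩ := hz e he
  rw [contDiffGroupoid, mem_groupoid_of_pregroupoid] at h1 h2 ⊢
  rw [mem_groupoid_of_pregroupoid]
  exact ⟨⟨ContDiffOn.restrict_scalars ℝ h1.1, ContDiffOn.restrict_scalars ℝ h1.2⟩,
    ⟨ContDiffOn.restrict_scalars ℝ h2.1, ContDiffOn.restrict_scalars ℝ h2.2⟩⟩

lemma hasMFDerivAt_restrictScalars {f : M → ℂ} {p : M} {f' : ℂ →L[ℂ] ℂ}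
    (h : HasMFDerivAt 𝓘(ℂ, ℂ) 𝓘(ℂ, ℂ) f p f') :
    HasMFDerivAt 𝓘(ℝ, ℂ) 𝓘(ℝ, ℂ) f p (f'.restrictScalars ℝ : ℂ →L[ℝ] ℂ) := by
  refine ⟨h.1, ?_⟩
  exact HasFDerivWithinAt.restrictScalars ℝ h.2

end Chart

section Coordinates

/-- The differential of the coordinate `z`, as a map into `ℂ`. -/
def coordDeriv {M : Type*} [TopologicalSpace M] [ChartedSpace ℂ M] (z : OpenPartialHomeomorph M ℂ)
    (p : M) : TM p →L[ℝ] ℂ :=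
  mfderiv 𝓘(ℝ, ℂ) 𝓘(ℝ, ℂ) z p

variable {M : Type*} [TopologicalSpace M] [ChartedSpace ℂ M] [IsManifold 𝓘(ℂ, ℂ) ω M]
  {z : OpenPartialHomeomorph M ℂ}
  (hz : z ∈ IsManifold.maximalAtlas 𝓘(ℂ, ℂ) ω M)

include hz

lemma coord_mdifferentiable : z.MDifferentiable 𝓘(ℝ, ℂ) 𝓘(ℝ, ℂ) :=
  ⟨(contMDiffOn_of_mem_maximalAtlas (mem_maximalAtlas_real hz)).mdifferentiableOn (by simp),
    (contMDiffOn_symm_of_mem_maximalAtlas (mem_maximalAtlas_real hz)).mdifferentiableOn (by simp)⟩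

lemma coord_contMDiffAt {p : M} (hp : p ∈ z.source) : ContMDiffAt 𝓘(ℝ, ℂ) 𝓘(ℝ, ℂ) ω z p :=
  contMDiffAt_of_mem_maximalAtlas (mem_maximalAtlas_real hz) hp

lemma coord_isInvertible {p : M} (hp : p ∈ z.source) :
    (mfderiv 𝓘(ℝ, ℂ) 𝓘(ℝ, ℂ) z p).IsInvertible :=
  ⟨(coord_mdifferentiable hz).mfderiv hp, rfl⟩

omit hz [IsManifold 𝓘(ℂ, ℂ) ω M] in
lemma coordField_eq_inverse (v : ℂ) (p : M) : coordField z v p = (coordDeriv z p).inverse v := rfl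

lemma coordDeriv_coordField {p : M} (hp : p ∈ z.source) (v : ℂ) :
    coordDeriv z p (coordField z v p) = v := by
  obtain ⟨e, he⟩ : (coordDeriv z p).IsInvertible := coord_isInvertible hz hp
  rw [coordField_eq_inverse, ← he]
  simp

lemma coordField_coordDeriv {p : M} (hp : p ∈ z.source) (u : TM p) :
    coordField z (coordDeriv z p u) p = u := by
  obtain ⟨e, he⟩ : (coordDeriv z p).IsInvertible := coord_isInvertible hz hp
  rw [coordField_eq_inverse, ← he]
  simp

omit [IsManifold 𝓘(ℂ, ℂ) ω M] in
-- Holomorphy enters here: the real differential of `z` is the restriction of a complex linear map.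
lemma coordDeriv_cplx {p : M} (hp : p ∈ z.source) (u : TM p) :
    coordDeriv z p (cplx p u) = Complex.I * coordDeriv z p u := by
  have h1 : MDifferentiableAt 𝓘(ℂ, ℂ) 𝓘(ℂ, ℂ) z p :=
    (contMDiffAt_of_mem_maximalAtlas hz hp).mdifferentiableAt (by simp)
  have h2 := hasMFDerivAt_restrictScalars h1.hasMFDerivAt
  rw [coordDeriv, h2.mfderiv]
  exact (mfderiv 𝓘(ℂ, ℂ) 𝓘(ℂ, ℂ) z p : ℂ →L[ℂ] ℂ).map_smul Complex.I u

lemma cplx_coordField {p : M} (hp : p ∈ z.source) (v : ℂ) :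
    cplx p (coordField z v p) = coordField z (Complex.I * v) p := by
  rw [← coordField_coordDeriv hz hp (cplx p (coordField z v p)), coordDeriv_cplx hz hp,
    coordDeriv_coordField hz hp]

/-- The constant vector field on the plane. -/
def constField (v : ℂ) : ∀ q : ℂ, TangentSpace 𝓘(ℝ, ℂ) q := fun _ => v

omit hz in
lemma constField_contMDiffAt (v : ℂ) (m : WithTop ℕ∞) (q : ℂ) :
    ContMDiffAt 𝓘(ℝ, ℂ) 𝓘(ℝ, ℂ).tangent m
      (fun q : ℂ => (⟨q, constField v q⟩ : TangentBundle 𝓘(ℝ, ℂ) ℂ)) q :=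
  (contMDiffAt_vectorSpace_iff_contDiffAt (V := constField v)).2 contDiffAt_const

lemma coordField_smooth (v : ℂ) : SmoothField (coordField z v) z.source := by
  intro p hp
  exact (ContMDiffAt.mpullback_vectorField_preimage (n := ω) (constField_contMDiffAt v ∞ _)
    (coord_contMDiffAt hz hp) (coord_isInvertible hz hp) (by simp)).contMDiffWithinAt

/-- Pullback commutes with the bracket, and constant fields on the plane commute. The bracket terms
thus disappear from the torsion and curvature identities. -/
lemma mlieBracket_coordField {p : M} (hp : p ∈ z.source) (v v' : ℂ) :
    mlieBracket 𝓘(ℝ, ℂ) (coordField z v) (coordField z v') p = 0 := by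
  have hs (v : ℂ) := (constField_contMDiffAt v 1 (z p)).mdifferentiableAt (by simp)
  have : IsManifold 𝓘(ℝ, ℂ) (minSmoothness ℝ 2) M := by
    rw [minSmoothness_of_isRCLikeNormedField]
    infer_instance
  have h := mpullback_mlieBracket (V := constField v) (W := constField v') (hs v) (hs v')
    (coord_contMDiffAt hz hp) (by rw [minSmoothness_of_isRCLikeNormedField]; simp)
  have h0 : mlieBracket 𝓘(ℝ, ℂ) (constField v) (constField v') = 0 := by
    rw [← mlieBracketWithin_univ, mlieBracketWithin_eq_lieBracketWithin]
    ext q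
    have hc (v : ℂ) : fderivWithin ℝ (constField v) univ q = 0 := by
      change fderivWithin ℝ (fun _ : ℂ => v) univ q = 0
      simp
    change (fderivWithin ℝ (constField v') univ q : ℂ →L[ℝ] ℂ) v
      - (fderivWithin ℝ (constField v) univ q : ℂ →L[ℝ] ℂ) v' = 0
    rw [hc, hc]
    exact sub_self (0 : ℂ)
  rw [h0, mpullback_zero] at h
  exact h.symm

end Coordinates

/-! ### Christoffel symbols and the conformal form of the metric. -/

section CoordinateConnection

variable {M : Type*} [TopologicalSpace M] [ChartedSpace ℂ M] [IsManifold 𝓘(ℂ, ℂ) ω M]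
  {U : Set M} (S : SpecialKahlerOn U) {z : OpenPartialHomeomorph M ℂ}
  (hz : z ∈ IsManifold.maximalAtlas 𝓘(ℂ, ℂ) ω M)

omit [IsManifold 𝓘(ℂ, ℂ) ω M] in
lemma coordField_add (z : OpenPartialHomeomorph M ℂ) (v v' : ℂ) :
    coordField z (v + v') = coordField z v + coordField z v' := by
  ext1 p
  simp only [Pi.add_apply, coordField_eq_inverse, map_add]

omit [IsManifold 𝓘(ℂ, ℂ) ω M] in
lemma coordField_smul (z : OpenPartialHomeomorph M ℂ) (c : ℝ) (v : ℂ) :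
    coordField z (c • v) = c • coordField z v := by
  ext1 p
  simp only [Pi.smul_apply, coordField_eq_inverse, map_smul]

omit [IsManifold 𝓘(ℂ, ℂ) ω M] in
lemma coordField_eq_re_im (z : OpenPartialHomeomorph M ℂ) (v : ℂ) (p : M) :
    coordField z v p = v.re • coordField z 1 p + v.im • coordField z Complex.I p := by
  have h : v = v.re • (1 : ℂ) + v.im • Complex.I := by simp [Complex.re_add_im]
  conv_lhs => rw [h]
  rw [coordField_add, coordField_smul, coordField_smul]
  rfl

/-- The Christoffel symbols: the coordinates of `∇_ξ v` at `p` for the constant fields `ξ`, `v`. -/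
def christoffel (z : OpenPartialHomeomorph M ℂ) (p : M) (ξ v : ℂ) : ℂ :=
  coordDeriv z p (S.cov (coordField z v) p (coordField z ξ p))

lemma christoffel_left (p : M) (ξ v : ℂ) :
    christoffel S z p ξ v = ξ.re * christoffel S z p 1 v + ξ.im * christoffel S z p Complex.I v := by
  simp only [christoffel]
  rw [coordField_eq_re_im z ξ p]
  simp only [map_add, map_smul, Complex.real_smul]

include hz

lemma coordField_mdifferentiableAt {p : M} (hp : p ∈ z.source) (v : ℂ) :
    MDifferentiableAt 𝓘(ℝ, ℂ) 𝓘(ℝ, ℂ).tangent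
      (fun q => (⟨q, coordField z v q⟩ : TangentBundle 𝓘(ℝ, ℂ) M)) p :=
  ((coordField_smooth hz v p hp).contMDiffAt (z.open_source.mem_nhds hp)).mdifferentiableAt (by simp)

/-- The Leibniz rule for a vector field with variable coordinates. -/
lemma cov_variable_coordField {p : M} (hp : p ∈ z.source) (hpU : p ∈ U) {F : M → ℂ}
    (hF : MDifferentiableAt 𝓘(ℝ, ℂ) 𝓘(ℝ, ℂ) F p) (u : TM p) :
    MDifferentiableAt 𝓘(ℝ, ℂ) 𝓘(ℝ, ℂ).tangent
        (fun q => (⟨q, coordField z (F q) q⟩ : TangentBundle 𝓘(ℝ, ℂ) M)) p ∧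
    coordDeriv z p (S.cov (fun q => coordField z (F q) q) p u) =
      mvfderiv 𝓘(ℝ, ℂ) F p u
        + ((F p).re * coordDeriv z p (S.cov (coordField z 1) p u)
        + (F p).im * coordDeriv z p (S.cov (coordField z Complex.I) p u)) := by
  have hre : HasMFDerivAt 𝓘(ℝ, ℂ) 𝓘(ℝ, ℝ) (fun q => (F q).re) p
      (Complex.reCLM.comp (mfderiv 𝓘(ℝ, ℂ) 𝓘(ℝ, ℂ) F p)) :=
    (Complex.reCLM.hasMFDerivAt (x := F p)).comp p hF.hasMFDerivAt
  have him : HasMFDerivAt 𝓘(ℝ, ℂ) 𝓘(ℝ, ℝ) (fun q => (F q).im) p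
      (Complex.imCLM.comp (mfderiv 𝓘(ℝ, ℂ) 𝓘(ℝ, ℂ) F p)) :=
    (Complex.imCLM.hasMFDerivAt (x := F p)).comp p hF.hasMFDerivAt
  have h1 := coordField_mdifferentiableAt hz hp 1
  have hI := coordField_mdifferentiableAt hz hp Complex.I
  have e : (fun q => coordField z (F q) q)
      = (fun q => (F q).re) • coordField z 1 + (fun q => (F q).im) • coordField z Complex.I := by
    ext1 q
    exact coordField_eq_re_im z (F q) q
  have d1 := hre.mdifferentiableAt.smul_section h1
  have d2 := him.mdifferentiableAt.smul_section hI
  have d := mdifferentiableAt_add_section d1 d2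
  rw [← e] at d
  refine ⟨d, ?_⟩
  rw [e]
  rw [S.cov_isCovariantDerivative.add d1 d2 hpU,
    S.cov_isCovariantDerivative.leibniz h1 hre.mdifferentiableAt hpU,
    S.cov_isCovariantDerivative.leibniz hI him.mdifferentiableAt hpU]
  have m1 : mvfderiv 𝓘(ℝ, ℂ) (fun q => (F q).re) p u = (mvfderiv 𝓘(ℝ, ℂ) F p u).re := by
    rw [mvfderiv, hre.mfderiv]
    rfl
  have mI : mvfderiv 𝓘(ℝ, ℂ) (fun q => (F q).im) p u = (mvfderiv 𝓘(ℝ, ℂ) F p u).im := by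
    rw [mvfderiv, him.mfderiv]
    rfl
  simp only [add_apply, smul_apply, map_add, map_smul,
    ContinuousLinearMap.smulRight_apply, coordDeriv_coordField hz hp, Complex.real_smul, m1, mI]
  conv_rhs => rw [← Complex.re_add_im (mvfderiv 𝓘(ℝ, ℂ) F p u)]
  ring


omit hz in
/-- Two fields which agree near `p` have the same covariant derivative there, if the second one is
differentiable. -/
lemma cov_congr (hU : IsOpen U) {p : M} (hpU : p ∈ U) {Y Y' : ∀ p : M, TM p}
    (hY' : MDifferentiableAt 𝓘(ℝ, ℂ) 𝓘(ℝ, ℂ).tangent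
      (fun q => (⟨q, Y' q⟩ : TangentBundle 𝓘(ℝ, ℂ) M)) p)
    (h : ∀ᶠ q in 𝓝 p, Y q = Y' q) : S.cov Y p = S.cov Y' p := by
  refine S.cov_isCovariantDerivative.congr_of_eventuallyEq ?_ hY' (hU.mem_nhds hpU) h
  refine hY'.congr_of_eventuallyEq ?_
  filter_upwards [h] with q hq
  rw [hq]

lemma christoffel_right {p : M} (hp : p ∈ z.source) (hpU : p ∈ U) (ξ v : ℂ) :
    christoffel S z p ξ v
      = v.re * christoffel S z p ξ 1 + v.im * christoffel S z p ξ Complex.I := by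
  have h := (cov_variable_coordField S hz hp hpU (F := fun _ => v) mdifferentiableAt_const
    (coordField z ξ p)).2
  rw [show mvfderiv 𝓘(ℝ, ℂ) (fun _ : M => v) p = 0 from mvfderiv_const v] at h
  rw [christoffel, h, christoffel, christoffel]
  simp

lemma cov_cplx_coordField (hU : IsOpen U) {p : M} (hp : p ∈ z.source) (hpU : p ∈ U) (v : ℂ) :
    S.cov (fun q => cplx q (coordField z v q)) p = S.cov (coordField z (Complex.I * v)) p := by
  refine cov_congr S hU hpU (coordField_mdifferentiableAt hz hp _) ?_
  filter_upwards [z.open_source.mem_nhds hp] with q hq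
  exact cplx_coordField hz hq v

lemma smoothField_inter (v : ℂ) : SmoothField (coordField z v) (z.source ∩ U) :=
  (coordField_smooth hz v).mono inter_subset_left

lemma christoffel_symm (hU : IsOpen U) {p : M} (hp : p ∈ z.source) (hpU : p ∈ U) (ξ v : ℂ) :
    christoffel S z p ξ v = christoffel S z p v ξ := by
  have h := S.torsion_free (z.source ∩ U) inter_subset_right (z.open_source.inter hU)
    (coordField z ξ) (coordField z v) (smoothField_inter hz ξ) (smoothField_inter hz v) p ⟨hp, hpU⟩
  rw [mlieBracket_coordField hz hp, sub_eq_zero] at h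
  rw [christoffel, christoffel, h]

lemma christoffel_special (hU : IsOpen U) {p : M} (hp : p ∈ z.source) (hpU : p ∈ U) (ξ v : ℂ) :
    christoffel S z p ξ (Complex.I * v) - Complex.I * christoffel S z p ξ v
      = christoffel S z p v (Complex.I * ξ) - Complex.I * christoffel S z p v ξ := by
  have h := S.special (z.source ∩ U) inter_subset_right (z.open_source.inter hU)
    (coordField z ξ) (coordField z v) (smoothField_inter hz ξ) (smoothField_inter hz v) p ⟨hp, hpU⟩
  rw [cov_cplx_coordField S hz hU hp hpU, cov_cplx_coordField S hz hU hp hpU] at h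
  have h' := congrArg (coordDeriv z p) h
  rw [map_sub, map_sub, coordDeriv_cplx hz hp, coordDeriv_cplx hz hp] at h'
  exact h'

/-- The field `∇_ξ v` is smooth by smoothness of `∇`, and its coordinates are the fibre component of
its image under the tangent map of `z`. -/
lemma christoffel_mdifferentiableAt (hU : IsOpen U) {p : M} (hp : p ∈ z.source) (hpU : p ∈ U)
    (ξ v : ℂ) :
    MDifferentiableAt 𝓘(ℝ, ℂ) 𝓘(ℝ, ℂ) (fun q => christoffel S z q ξ v) p := by
  have hV : z.source ∩ U ∈ 𝓝 p := (z.open_source.inter hU).mem_nhds ⟨hp, hpU⟩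
  have h1 := (S.cov_smooth (z.source ∩ U) inter_subset_right (z.open_source.inter hU)).contMDiff
    (smoothField_inter (U := U) hz v)
  have h2 : SmoothField (fun q => S.cov (coordField z v) q (coordField z ξ q)) (z.source ∩ U) :=
    ContMDiffOn.clm_bundle_apply h1 (smoothField_inter hz ξ)
  have h3 := (contMDiffOn_of_mem_maximalAtlas
    (mem_maximalAtlas_real hz)).contMDiffOn_tangentMapWithin (m := ∞) (by simp)
    z.open_source.uniqueMDiffOn
  have h4 := (contMDiff_snd_tangentBundle_modelSpace ℂ 𝓘(ℝ, ℂ) (n := ∞)).comp_contMDiffOn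
    (h3.comp h2 fun q hq => hq.1)
  have h5 := ((h4 p ⟨hp, hpU⟩).contMDiffAt hV).mdifferentiableAt (by simp)
  refine h5.congr_of_eventuallyEq ?_
  filter_upwards [z.open_source.mem_nhds hp] with q hq
  simp only [Function.comp, tangentMapWithin, christoffel]
  rw [mfderivWithin_of_isOpen z.open_source hq]
  rfl

/-- Invariance under `I` gives `∂_x` and `∂_y` equal length, and `g(∂_x, ∂_y) = -g(∂_y, ∂_x)` makes
them orthogonal. -/
lemma metric_coordField {p : M} (hp : p ∈ z.source) (hpU : p ∈ U) (u v : ℂ) :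
    S.g p (coordField z u p) (coordField z v p)
      = S.g p (coordField z 1 p) (coordField z 1 p) * (u * (starRingEnd ℂ) v).re := by
  have h1 := S.g_cplx p hpU (coordField z 1 p) (coordField z 1 p)
  have h2 := S.g_cplx p hpU (coordField z 1 p) (coordField z Complex.I p)
  have h3 := S.g_symm p hpU (coordField z 1 p) (coordField z Complex.I p)
  have hneg : coordField z (-1) p = - coordField z 1 p := by simp [coordField_eq_inverse]
  rw [cplx_coordField hz hp] at h1 h2
  rw [cplx_coordField hz hp] at h2
  simp only [mul_one, Complex.I_mul_I, hneg, map_neg] at h1 h2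
  rw [coordField_eq_re_im z u, coordField_eq_re_im z v]
  simp only [map_add, map_smul, add_apply, smul_apply, smul_eq_mul, Complex.mul_re,
    Complex.conj_re, Complex.conj_im]
  rw [h1, ← h3]
  have h4 : S.g p (coordField z 1 p) (coordField z Complex.I p) = 0 := by linarith
  rw [h4]
  ring

end CoordinateConnection

/-! ### The structure equations in terms of `w`, `P` and `A`. -/

section NormalForm

variable {M : Type*} [TopologicalSpace M] [ChartedSpace ℂ M] [IsManifold 𝓘(ℂ, ℂ) ω M]
  {U : Set M} (S : SpecialKahlerOn U) {z : OpenPartialHomeomorph M ℂ}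
  (hz : z ∈ IsManifold.maximalAtlas 𝓘(ℂ, ℂ) ω M)

/-- The complex bilinear part of the Christoffel symbols. -/
def holPart (z : OpenPartialHomeomorph M ℂ) (p : M) : ℂ :=
  (christoffel S z p 1 1 - Complex.I * christoffel S z p 1 Complex.I) / 2

/-- The conjugate bilinear part of the Christoffel symbols. -/
def antiPart (z : OpenPartialHomeomorph M ℂ) (p : M) : ℂ :=
  (christoffel S z p 1 1 + Complex.I * christoffel S z p 1 Complex.I) / 2

include hz

/-- The symbols are symmetric because `∇` is torsion-free, and the special condition on the pair
`(1, i)` gives `Γ(i, i) = -Γ(1, 1)`. This eliminates the mixed terms `ξ v̄ + ξ̄ v` of a symmetric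
real bilinear map. -/
lemma christoffel_eq (hU : IsOpen U) {p : M} (hp : p ∈ z.source) (hpU : p ∈ U) (ξ v : ℂ) :
    christoffel S z p ξ v = holPart S z p * ξ * v + antiPart S z p * conj ξ * conj v := by
  have hs := christoffel_symm S hz hU hp hpU Complex.I 1
  have hI := christoffel_special S hz hU hp hpU 1 Complex.I
  have hneg : christoffel S z p 1 (-1) = - christoffel S z p 1 1 := by
    rw [christoffel_right S hz hp hpU]
    simp
  simp only [Complex.I_mul_I, mul_one, hneg, hs] at hI
  rw [christoffel_right S hz hp hpU, christoffel_left S p ξ 1, christoffel_left S p ξ Complex.I, hs]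
  have hII : christoffel S z p Complex.I Complex.I = - christoffel S z p 1 1 := by
    linear_combination -hI
  rw [hII, holPart, antiPart]
  conv_rhs => rw [← Complex.re_add_im ξ, ← Complex.re_add_im v]
  simp only [map_add, map_mul, Complex.conj_ofReal, Complex.conj_I]
  linear_combination (christoffel S z p 1 Complex.I * (ξ.re * v.im + ξ.im * v.re)
    - christoffel S z p 1 1 * (ξ.im * v.im)) * Complex.I_mul_I

/-- Since `w = ω(∂_x, ∂_y)` and `ω` is parallel, `d log w` is the trace of the connection form. The
conjugate linear part is trace-free, and `v ↦ P ξ v` has real trace `2 Re (P ξ)`. -/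
lemma metric_deriv (hU : IsOpen U) {p : M} (hp : p ∈ z.source) (hpU : p ∈ U) (ξ : ℂ) :
    mvfderiv 𝓘(ℝ, ℂ) (fun q => S.g q (coordField z 1 q) (coordField z 1 q)) p (coordField z ξ p)
      = 2 * S.g p (coordField z 1 p) (coordField z 1 p) * (holPart S z p * ξ).re := by
  have hV : z.source ∩ U ∈ 𝓝 p := (z.open_source.inter hU).mem_nhds ⟨hp, hpU⟩
  have h := S.symplectic (z.source ∩ U) inter_subset_right (z.open_source.inter hU)
    (coordField z ξ) (coordField z 1) (coordField z Complex.I) (smoothField_inter hz _)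
    (smoothField_inter hz _) (smoothField_inter hz _) p ⟨hp, hpU⟩
  have hc : (fun q => S.g q (cplx q (coordField z 1 q)) (coordField z Complex.I q)) =ᶠ[𝓝 p]
      fun q => S.g q (coordField z 1 q) (coordField z 1 q) := by
    filter_upwards [hV] with q hq
    rw [cplx_coordField hz hq.1, metric_coordField S hz hq.1 hq.2]
    simp
  have hcov (v : ℂ) : S.cov (coordField z v) p (coordField z ξ p)
      = coordField z (christoffel S z p ξ v) p := (coordField_coordDeriv hz hp _).symm
  have hm : mvfderiv 𝓘(ℝ, ℂ) (fun q => S.g q (cplx q (coordField z 1 q)) (coordField z Complex.I q)) p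
      = mvfderiv 𝓘(ℝ, ℂ) (fun q => S.g q (coordField z 1 q) (coordField z 1 q)) p := by
    ext1 u
    exact congrArg (fun L : TM p →L[ℝ] ℝ => L u) hc.mfderiv_eq
  rw [hm, hcov, hcov, cplx_coordField hz hp, cplx_coordField hz hp,
    christoffel_eq S hz hU hp hpU, christoffel_eq S hz hU hp hpU,
    metric_coordField S hz hp hpU _ Complex.I, metric_coordField S hz hp hpU (Complex.I * 1)] at h
  rw [h]
  simp
  ring

lemma flat_coord (hU : IsOpen U) {p : M} (hp : p ∈ z.source) (hpU : p ∈ U) (v : ℂ) :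
    mvfderiv 𝓘(ℝ, ℂ) (fun q => christoffel S z q Complex.I v) p (coordField z 1 p)
      - mvfderiv 𝓘(ℝ, ℂ) (fun q => christoffel S z q 1 v) p (coordField z Complex.I p)
      + christoffel S z p 1 (christoffel S z p Complex.I v)
      - christoffel S z p Complex.I (christoffel S z p 1 v) = 0 := by
  have hV : z.source ∩ U ∈ 𝓝 p := (z.open_source.inter hU).mem_nhds ⟨hp, hpU⟩
  have h := S.flat (z.source ∩ U) inter_subset_right (z.open_source.inter hU)
    (coordField z 1) (coordField z Complex.I) (coordField z v) (smoothField_inter hz _)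
    (smoothField_inter hz _) (smoothField_inter hz _) p ⟨hp, hpU⟩
  have hcov (ξ u : ℂ) :
      coordDeriv z p (S.cov (fun q => S.cov (coordField z v) q (coordField z ξ q)) p
        (coordField z u p))
      = mvfderiv 𝓘(ℝ, ℂ) (fun q => christoffel S z q ξ v) p (coordField z u p)
        + christoffel S z p u (christoffel S z p ξ v) := by
    have h1 := cov_variable_coordField S hz hp hpU
      (christoffel_mdifferentiableAt S hz hU hp hpU ξ v) (coordField z u p)
    rw [cov_congr S hU hpU h1.1, h1.2, christoffel_right S hz hp hpU u]
    · rfl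
    · filter_upwards [z.open_source.mem_nhds hp] with q hq
      exact (coordField_coordDeriv hz hq _).symm
  have h' := congrArg (coordDeriv z p) h
  rw [mlieBracket_coordField hz hp, map_zero, sub_zero, map_sub, hcov, hcov, map_zero] at h'
  linear_combination h'

/-- The derivative of `π^(1,0)` measures the failure of `∇` to commute with `I`, which is the
conjugate linear part: on `∂_x` in the direction `∂_x` its real component is zero and its imaginary
component is `i A`. -/
lemma cubicForm_coordField (hU : IsOpen U) {p : M} (hp : p ∈ z.source) (hpU : p ∈ U) :
    S.cubicForm (coordField z 1) (coordField z 1) (coordField z 1) p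
      = -(Complex.I / 2) * (S.g p (coordField z 1 p) (coordField z 1 p) : ℝ)
        * conj (antiPart S z p) := by
  have e1 : S.cov (proj (coordField z 1)).1 p = (1 / 2 : ℝ) • S.cov (coordField z 1) p :=
    S.cov_isCovariantDerivative.smul_const (1 / 2 : ℝ) (coordField_mdifferentiableAt hz hp 1) hpU
  have e2 : S.cov (proj (coordField z 1)).2 p = -(1 / 2 : ℝ) • S.cov (coordField z Complex.I) p := by
    rw [← S.cov_isCovariantDerivative.smul_const (-(1 / 2) : ℝ)
      (coordField_mdifferentiableAt hz hp Complex.I) hpU]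
    refine cov_congr S hU hpU ?_ ?_
    · have := coordField_mdifferentiableAt hz hp ((-(1 / 2) : ℝ) • Complex.I)
      rw [coordField_smul] at this
      exact this
    · filter_upwards [z.open_source.mem_nhds hp] with q hq
      simp only [proj, cplx_coordField hz hq, mul_one, Pi.smul_apply, neg_smul]
  have hcov (v : ℂ) : S.cov (coordField z v) p (coordField z 1 p)
      = coordField z (christoffel S z p 1 v) p := (coordField_coordDeriv hz hp _).symm
  have hc1 : (S.covProj (coordField z 1) (coordField z 1) p).1 = coordField z 0 p := by
    change S.cov (proj (coordField z 1)).1 p (coordField z 1 p)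
      - (1 / 2 : ℝ) • S.cov (coordField z 1) p (coordField z 1 p) = _
    rw [e1]
    simp [coordField_eq_inverse]
  have hc2 : (S.covProj (coordField z 1) (coordField z 1) p).2
      = coordField z (Complex.I * antiPart S z p) p := by
    change S.cov (proj (coordField z 1)).2 p (coordField z 1 p)
      - -((1 / 2 : ℝ) • cplx p (S.cov (coordField z 1) p (coordField z 1 p))) = _
    rw [e2, smul_apply, hcov, hcov, cplx_coordField hz hp]
    have : Complex.I * antiPart S z p = (-(1 / 2) : ℝ) • christoffel S z p 1 Complex.I
        + (1 / 2 : ℝ) • (Complex.I * christoffel S z p 1 1) := by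
      rw [antiPart]
      simp only [Complex.real_smul]
      push_cast
      linear_combination (christoffel S z p 1 Complex.I / 2) * Complex.I_mul_I
    rw [this, coordField_add, coordField_smul, coordField_smul]
    simp
  have hp1 : (proj (coordField z 1)).1 p = coordField z (1 / 2 : ℝ) p := by
    have : ((1 / 2 : ℝ) : ℂ) = (1 / 2 : ℝ) • (1 : ℂ) := by simp
    rw [this, coordField_smul]
    rfl
  have hp2 : (proj (coordField z 1)).2 p = coordField z ((-(1 / 2) : ℝ) • Complex.I) p := by
    rw [coordField_smul]
    simp [proj, cplx_coordField hz hp]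
  simp only [cubicForm, kahlerFormC, kahlerForm, hc1, hc2, hp1, hp2, cplx_coordField hz hp]
  rw [metric_coordField S hz hp hpU _ 0, metric_coordField S hz hp hpU _ 0,
    metric_coordField S hz hp hpU (Complex.I * _) (Complex.I * _),
    metric_coordField S hz hp hpU (Complex.I * _) (Complex.I * _)]
  apply Complex.ext <;> simp <;> ring

end NormalForm

lemma mvfderiv_congr {M : Type*} [TopologicalSpace M] [ChartedSpace ℂ M] {E : Type*}
    [NormedAddCommGroup E] [NormedSpace ℝ E] {f g : M → E} {p : M} (h : f =ᶠ[𝓝 p] g) :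
    mvfderiv 𝓘(ℝ, ℂ) f p = mvfderiv 𝓘(ℝ, ℂ) g p := by
  ext1 u
  exact congrArg (fun L : TM p →L[ℝ] E => L u) h.mfderiv_eq

/-! ### Transfer to functions on the coordinate domain. -/

section InCoordinate

variable {M : Type*} [TopologicalSpace M] [ChartedSpace ℂ M] [IsManifold 𝓘(ℂ, ℂ) ω M]
  {U : Set M} (S : SpecialKahlerOn U) {z : OpenPartialHomeomorph M ℂ}
  (hz : z ∈ IsManifold.maximalAtlas 𝓘(ℂ, ℂ) ω M)

include hz

/-- The differential of `z.symm` sends `v` to the coordinate field of `v`, so derivatives along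
coordinate fields are ordinary partial derivatives. -/
lemma hasFDerivAt_comp_symm {E : Type*} [NormedAddCommGroup E] [NormedSpace ℝ E] {F : M → E}
    {ζ : ℂ} (hζ : ζ ∈ z.target) (hF : MDifferentiableAt 𝓘(ℝ, ℂ) 𝓘(ℝ, E) F (z.symm ζ)) :
    ∃ L : ℂ →L[ℝ] E, HasFDerivAt (fun η => F (z.symm η)) L ζ ∧
      ∀ v, L v = mvfderiv 𝓘(ℝ, ℂ) F (z.symm ζ) (coordField z v (z.symm ζ)) := by
  have hs : MDifferentiableAt 𝓘(ℝ, ℂ) 𝓘(ℝ, ℂ) z.symm ζ :=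
    (coord_mdifferentiable hz).mdifferentiableAt_symm hζ
  have h := hF.hasMFDerivAt.comp ζ hs.hasMFDerivAt
  refine ⟨_, hasMFDerivAt_iff_hasFDerivAt.1 h, fun v => ?_⟩
  have hd : (mfderiv 𝓘(ℝ, ℂ) 𝓘(ℝ, ℂ) z.symm ζ : ℂ →L[ℝ] TM (z.symm ζ)) v
      = coordField z v (z.symm ζ) := by
    rw [← coordField_coordDeriv hz (z.map_target hζ)
      ((mfderiv 𝓘(ℝ, ℂ) 𝓘(ℝ, ℂ) z.symm ζ : ℂ →L[ℝ] TM (z.symm ζ)) v)]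
    congr 1
    have h1 := (coord_mdifferentiable hz).comp_symm_deriv hζ
    exact congrArg (fun L : ℂ →L[ℝ] ℂ => L v) h1
  rw [← hd]
  rfl

lemma metric_mdifferentiableAt (hU : IsOpen U) {p : M} (hp : p ∈ z.source) (hpU : p ∈ U) :
    MDifferentiableAt 𝓘(ℝ, ℂ) 𝓘(ℝ, ℝ)
      (fun q => S.g q (coordField z 1 q) (coordField z 1 q)) p := by
  have hV : z.source ∩ U ∈ 𝓝 p := (z.open_source.inter hU).mem_nhds ⟨hp, hpU⟩
  have h1 := (S.g_smooth.mono (inter_subset_right : z.source ∩ U ⊆ U)) p ⟨hp, hpU⟩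
  have hX := smoothField_inter (U := U) hz 1 p ⟨hp, hpU⟩
  have : ContMDiffWithinAt 𝓘(ℝ, ℂ) (𝓘(ℝ, ℂ).prod 𝓘(ℝ)) ∞
      (fun q => Bundle.TotalSpace.mk' ℝ (E := Bundle.Trivial M ℝ) q
        (S.g q (coordField z 1 q) (coordField z 1 q))) (z.source ∩ U) p := by
    apply ContMDiffWithinAt.clm_bundle_apply₂ (F₁ := ℂ) (F₂ := ℂ)
    · exact h1
    · exact hX
    · exact hX
  rw [Bundle.contMDiffWithinAt_totalSpace] at this
  exact (this.2.contMDiffAt hV).mdifferentiableAt (by simp)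

/-- In a coordinate, an affine special Kähler structure is determined by the functions `w`, `P` and
`A` with `g = w |dz|²` and `ω_∇(ξ) v = P ξ v + A ξ̄ v̄`. -/
lemma special_kahler_in_coordinate (hU : IsOpen U) {ζ : ℂ} (hζ : ζ ∈ z.target)
    (hζU : z.symm ζ ∈ U) :
    (∀ ξ v, S.connVec z ζ ξ v = holPart S z (z.symm ζ) * ξ * v
      + antiPart S z (z.symm ζ) * conj ξ * conj v) ∧
    0 < S.metricCoeff z ζ ∧
    (∃ L : ℂ →L[ℝ] ℝ, HasFDerivAt (S.metricCoeff z) L ζ ∧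
      ∀ ξ, L ξ = 2 * S.metricCoeff z ζ * (holPart S z (z.symm ζ) * ξ).re) ∧
    (∃ L : ℂ →L[ℝ] ℂ, HasFDerivAt (fun η => holPart S z (z.symm η)) L ζ ∧
      L 1 + Complex.I * L Complex.I = -2 * (‖antiPart S z (z.symm ζ)‖ : ℂ) ^ 2) ∧
    S.cubicCoeff z ζ = -(Complex.I / 2) * S.metricCoeff z ζ * conj (antiPart S z (z.symm ζ)) := by
  have hp := z.map_target hζ
  refine ⟨christoffel_eq S hz hU hp hζU, ?_, ?_, ?_, cubicForm_coordField S hz hU hp hζU⟩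
  · refine S.g_pos _ hζU _ fun h0 => ?_
    have := coordDeriv_coordField hz hp 1
    rw [h0, map_zero] at this
    exact zero_ne_one this
  · obtain ⟨L, hL, hv⟩ := hasFDerivAt_comp_symm hz hζ (metric_mdifferentiableAt S hz hU hp hζU)
    exact ⟨L, hL, fun ξ => (hv ξ).trans (metric_deriv S hz hU hp hζU ξ)⟩
  · have hd (ξ v : ℂ) := hasFDerivAt_comp_symm hz hζ (christoffel_mdifferentiableAt S hz hU hp hζU ξ v)
    have hflat := flat_coord S hz hU hp hζU
    obtain ⟨L1, h1, e1⟩ := hd 1 1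
    obtain ⟨LI, hI, eI⟩ := hd 1 Complex.I
    have hnear : z.source ∩ U ∈ 𝓝 (z.symm ζ) := (z.open_source.inter hU).mem_nhds ⟨hp, hζU⟩
    have hI1 : mvfderiv 𝓘(ℝ, ℂ) (fun q => christoffel S z q Complex.I 1) (z.symm ζ)
        = mvfderiv 𝓘(ℝ, ℂ) (fun q => christoffel S z q 1 Complex.I) (z.symm ζ) := by
      refine mvfderiv_congr ?_
      filter_upwards [hnear] with q hq
      exact christoffel_symm S hz hU hq.1 hq.2 _ _
    -- Together with symmetry, this leaves only derivatives of `Γ(1, 1)` and `Γ(1, i)`, the two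
    -- symbols that define `P`.
    have hII : mvfderiv 𝓘(ℝ, ℂ) (fun q => christoffel S z q Complex.I Complex.I) (z.symm ζ)
        = - mvfderiv 𝓘(ℝ, ℂ) (fun q => christoffel S z q 1 1) (z.symm ζ) := by
      rw [← mvfderiv_neg]
      refine mvfderiv_congr ?_
      filter_upwards [hnear] with q hq
      rw [Pi.neg_apply, christoffel_eq S hz hU hq.1 hq.2, christoffel_eq S hz hU hq.1 hq.2]
      simp only [Complex.conj_I, map_one]
      linear_combination (holPart S z q + antiPart S z q) * Complex.I_mul_I
    have f1 := hflat 1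
    have f2 := hflat Complex.I
    rw [hI1, ← eI, ← e1] at f1
    rw [hII, neg_apply, ← eI, ← e1] at f2
    simp only [christoffel_eq S hz hU hp hζU, map_add, map_mul, map_neg, Complex.conj_I, neg_neg,
      map_one, mul_one] at f1 f2
    refine ⟨(1 / 2 : ℂ) • (L1 - Complex.I • LI), ?_, ?_⟩
    · refine ((h1.sub (hI.const_smul Complex.I)).const_smul (1 / 2 : ℂ)).congr_of_eventuallyEq
        (.of_forall fun η => ?_)
      simp only [holPart, Pi.smul_apply, Pi.sub_apply, smul_eq_mul]
      ring
    · rw [← Complex.mul_conj']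
      simp only [smul_apply, sub_apply, smul_eq_mul]
      set P := holPart S z (z.symm ζ)
      set A := antiPart S z (z.symm ζ)
      -- Flatness on `∂_x` and `∂_y` is combined so that the derivative terms assemble to `(∂_x + i
      -- ∂_y) P`; the quadratic terms leave only `|A|²`.
      linear_combination -(1 / 2) * f2 - (Complex.I / 2) * f1
        + (2 * A * conj A - LI Complex.I / 2) * Complex.I_mul_I

end InCoordinate

/-! ### Matrix one-forms in the frame `dρ`, `dθ`. -/

section Forms

/-- The real matrix of the map `v ↦ e v + α v̄`. -/
def realMatrix (e α : ℂ) : Matrix (Fin 2) (Fin 2) ℝ :=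
  !![e.re + α.re, -e.im + α.im; e.im + α.im, e.re - α.re]

lemma abs_realMatrix_le (e α : ℂ) (i j : Fin 2) : |realMatrix e α i j| ≤ ‖e‖ + ‖α‖ := by
  have h1 := abs_le.1 (Complex.abs_re_le_norm e)
  have h2 := abs_le.1 (Complex.abs_im_le_norm e)
  have h3 := abs_le.1 (Complex.abs_re_le_norm α)
  have h4 := abs_le.1 (Complex.abs_im_le_norm α)
  rw [abs_le]
  fin_cases i <;> fin_cases j <;> simp [realMatrix] <;> constructor <;> linarith

/-- The matrix valued one-form `(v ↦ e v + α v̄) dρ + (v ↦ i e v - i α v̄) dθ`. -/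
def complexForm (e α : ℂ → ℂ) (ζ ξ : ℂ) : Matrix (Fin 2) (Fin 2) ℝ :=
  dTheta ζ ξ • realMatrix (Complex.I * e ζ) (-Complex.I * α ζ) + dRho ζ ξ • realMatrix (e ζ) (α ζ)

lemma flatConeForm_eq (β : ℝ) (ζ ξ : ℂ) :
    flatConeForm β ζ ξ = complexForm (fun _ => (β / 2 : ℝ)) (fun _ => 0) ζ ξ := by
  ext i j
  fin_cases i <;> fin_cases j <;> simp [flatConeForm, complexForm, realMatrix, matI] <;> ring

lemma logForm_eq (k : ℤ) (b ζ ξ : ℂ) :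
    logForm k b ζ ξ = complexForm (fun ζ => ((k / 2 + (rho ζ)⁻¹ / 2 : ℝ) : ℂ))
      (fun ζ => -(((rho ζ)⁻¹ / 2 : ℝ) * conj (phase k b ζ))) ζ ξ := by
  ext i j
  fin_cases i <;> fin_cases j <;>
    simp [logForm, complexForm, realMatrix, matI, -Complex.ofReal_inv, -Complex.ofReal_div,
      -Complex.ofReal_add] <;> ring

lemma realMatrix_isLittleO {e α : ℂ → ℂ} {f : ℂ → ℝ} (he : e =o[𝓝[≠] 0] f)
    (hα : α =o[𝓝[≠] 0] f) (i j : Fin 2) :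
    (fun ζ => realMatrix (e ζ) (α ζ) i j) =o[𝓝[≠] 0] f := by
  refine IsBigO.trans_isLittleO (IsBigO.of_bound 1 (.of_forall fun ζ => ?_))
    (he.norm_left.add hα.norm_left)
  rw [one_mul, Real.norm_eq_abs, Real.norm_eq_abs]
  exact (abs_realMatrix_le _ _ i j).trans (le_abs_self _)

/-- The `dθ` coefficients are the `dρ` coefficients multiplied by `±i`, so the same two scalar
errors control both components. -/
lemma asympForms_complexForm {e α e₀ α₀ : ℂ → ℂ} {f h : ℂ → ℝ}
    (hef : (fun ζ => e ζ - e₀ ζ) =o[𝓝[≠] 0] f) (heh : (fun ζ => e ζ - e₀ ζ) =o[𝓝[≠] 0] h)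
    (hαf : (fun ζ => α ζ - α₀ ζ) =o[𝓝[≠] 0] f) (hαh : (fun ζ => α ζ - α₀ ζ) =o[𝓝[≠] 0] h)
    {B B₀ : ℂ → ℂ → Matrix (Fin 2) (Fin 2) ℝ}
    (hB : ∀ᶠ ζ in 𝓝[≠] 0, ∀ ξ, B ζ ξ = complexForm e α ζ ξ)
    (hB₀ : ∀ ζ ξ, B₀ ζ ξ = complexForm e₀ α₀ ζ ξ) : AsympForms B B₀ f h := by
  refine ⟨fun ζ => realMatrix (Complex.I * (e ζ - e₀ ζ)) (-Complex.I * (α ζ - α₀ ζ)),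
    fun ζ => realMatrix (e ζ - e₀ ζ) (α ζ - α₀ ζ), ?_, ?_, realMatrix_isLittleO heh hαh⟩
  · filter_upwards [hB] with ζ hζ ξ
    rw [hζ, hB₀]
    ext i j
    fin_cases i <;> fin_cases j <;> simp [complexForm, realMatrix] <;> ring
  · exact realMatrix_isLittleO (hef.const_mul_left Complex.I) (hαf.const_mul_left (-Complex.I))

/-- Substituting `ξ = ζ (dρ + i dθ)` turns the coefficients `P`, `A` into `P ζ`, `A ζ̄`, the
quantities estimated in logarithmic coordinates. -/
lemma connForm_eq_complexForm {M : Type*} [TopologicalSpace M] [ChartedSpace ℂ M]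
    [IsManifold 𝓘(ℂ, ℂ) ω M] {U : Set M} (S : SpecialKahlerOn U) {z : OpenPartialHomeomorph M ℂ}
    {P A : ℂ → ℂ} {ζ : ℂ} (hζ : ζ ≠ 0)
    (h : ∀ ξ v, S.connVec z ζ ξ v = P ζ * ξ * v + A ζ * conj ξ * conj v) (ξ : ℂ) :
    S.connForm z ζ ξ = complexForm (fun ζ => P ζ * ζ) (fun ζ => A ζ * conj ζ) ζ ξ := by
  have hξ : ξ = ζ * (dRho ζ ξ + dTheta ζ ξ * Complex.I) := by
    rw [dRho, dTheta, Complex.re_add_im, mul_div_cancel₀ _ hζ]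
  have e (v : ℂ) : S.connVec z ζ ξ v = P ζ * ζ * (dRho ζ ξ + dTheta ζ ξ * Complex.I) * v
      + A ζ * conj ζ * (dRho ζ ξ - dTheta ζ ξ * Complex.I) * conj v := by
    rw [h]
    conv_lhs => rw [hξ]
    simp only [map_mul, map_add, Complex.conj_ofReal, Complex.conj_I]
    ring
  ext i j
  fin_cases i <;> fin_cases j <;>
    simp only [SpecialKahlerOn.connForm, e, complexForm, realMatrix] <;>
    simp <;> ring

end Forms

lemma exp_rho_isLittleO {γ ε : ℝ} (h : ε < γ) :
    (fun ζ => Real.exp (γ * rho ζ)) =o[𝓝[≠] 0] fun ζ => Real.exp (ε * rho ζ) := by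
  have hrho : Tendsto rho (𝓝[≠] 0) atBot :=
    Real.tendsto_log_nhdsGT_zero.comp (tendsto_norm_nhdsNE_zero)
  rw [Real.isLittleO_exp_comp_exp_comp]
  have := hrho.const_mul_atBot_of_neg (sub_neg.2 h)
  exact this.congr fun ζ => by ring

end SpecialKahler

end

/-! ### The main theorem. -/

open SpecialKahler in
theorem theorem1p1 {M : Type*} [TopologicalSpace M] [T2Space M] [ChartedSpace ℂ M]
    [IsManifold 𝓘(ℂ, ℂ) ω M] (m₀ : M)
    (S : SpecialKahler.SpecialKahlerOn ({m₀}ᶜ : Set M))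
    (z : OpenPartialHomeomorph M ℂ) (hz : z ∈ IsManifold.maximalAtlas 𝓘(ℂ, ℂ) ω M)
    (hm₀ : m₀ ∈ z.source) (hz₀ : z m₀ = 0)
    (n : ℤ) (hn : S.HasCubicOrder z n) :
    (∀ β C : ℝ, β < n + 1 → 0 < C →
      Tendsto (fun ζ : ℂ => S.metricCoeff z ζ / ‖ζ‖ ^ β) (𝓝[≠] 0) (𝓝 C) →
      ∃ ε : ℝ, 0 < ε ∧
        SpecialKahler.AsympForms (S.connForm z) (SpecialKahler.flatConeForm β)
          (fun _ => 1) (fun ζ => Real.exp (ε * SpecialKahler.rho ζ))) ∧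
    (∀ C : ℝ, 0 < C →
      Tendsto (fun ζ : ℂ => S.metricCoeff z ζ / (-(‖ζ‖ ^ (n + 1) * Real.log ‖ζ‖)))
        (𝓝[≠] 0) (𝓝 C) →
      ∃ b : ℂ, ‖b‖ = 1 ∧
        SpecialKahler.AsympForms (S.connForm z) (SpecialKahler.logForm (n + 1) b)
          (fun ζ => (SpecialKahler.rho ζ)⁻¹) (fun ζ => (SpecialKahler.rho ζ)⁻¹)) := by
  obtain ⟨hmero, hord⟩ := hn
  -- Finite order gives `Ξ₀ = z^n G` with `G` analytic and `G(0) ≠ 0`; the constant `c` is `G(0)`.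
  obtain ⟨G, hG, hG0, hGz⟩ := (meromorphicOrderAt_eq_int_iff hmero).1 hord
  have hloc : ∀ᶠ ζ in 𝓝[≠] (0 : ℂ), ζ ∈ z.target ∧ z.symm ζ ∈ ({m₀}ᶜ : Set M) := by
    have ht : z.target ∈ 𝓝 (0 : ℂ) := z.open_target.mem_nhds (hz₀ ▸ z.map_source hm₀)
    filter_upwards [nhdsWithin_le_nhds ht, self_mem_nhdsWithin] with ζ h1 h2
    refine ⟨h1, fun h3 => h2 ?_⟩
    rw [mem_singleton_iff] at h3
    rw [mem_singleton_iff, ← z.right_inv h1, h3, hz₀]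
  have hcoord := hloc.mono fun ζ hζ =>
    special_kahler_in_coordinate S hz isOpen_compl_singleton hζ.1 hζ.2
  set P : ℂ → ℂ := fun ζ => holPart S z (z.symm ζ)
  set A : ℂ → ℂ := fun ζ => antiPart S z (z.symm ζ)
  have hdata : PuncturedData (S.metricCoeff z) P A G n (G 0) :=
    { pos := hcoord.mono fun ζ h => h.2.1
      deriv := hcoord.mono fun ζ h => h.2.2.1
      curvature := hcoord.mono fun ζ h => h.2.2.2.1
      cubic := by
        filter_upwards [hcoord, hGz] with ζ h1 h2
        rw [sub_zero, smul_eq_mul] at h2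
        rw [← h2]
        exact h1.2.2.2.2
      tendsto := hG.continuousAt.tendsto.mono_left nhdsWithin_le_nhds
      ne_zero := hG0 }
  have hform : ∀ᶠ ζ in 𝓝[≠] (0 : ℂ), ∀ ξ, S.connForm z ζ ξ
      = complexForm (fun ζ => P ζ * ζ) (fun ζ => A ζ * (starRingEnd ℂ) ζ) ζ ξ := by
    filter_upwards [hcoord, self_mem_nhdsWithin] with ζ h1 h2
    exact connForm_eq_complexForm S h2 h1.1
  refine ⟨fun β C hβ hC hw => ?_, fun C hC hw => ?_⟩
  · obtain ⟨γ, K, hγ, hbound⟩ := hdata.conical hβ hC hw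
    -- The error `o(1)` is the rate `0` case of the comparison of exponentials; halving `γ` turns
    -- the `O` bound into the required `o` bound.
    have hone : (fun ζ : ℂ => Real.exp (0 * rho ζ)) = fun _ => (1 : ℝ) := by
      funext ζ
      rw [zero_mul, Real.exp_zero]
    have he : (fun ζ => P ζ * ζ - (β / 2 : ℝ)) =O[𝓝[≠] 0] fun ζ => Real.exp (γ * rho ζ) :=
      IsBigO.of_bound K (hbound.mono fun ζ h => by simpa using h.1)
    have hα : (fun ζ => A ζ * (starRingEnd ℂ) ζ - 0) =O[𝓝[≠] 0] fun ζ => Real.exp (γ * rho ζ) :=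
      IsBigO.of_bound K (hbound.mono fun ζ h => by simpa using h.2)
    have h0 := exp_rho_isLittleO hγ
    rw [hone] at h0
    have h2 := exp_rho_isLittleO (half_lt_self hγ)
    exact ⟨γ / 2, half_pos hγ, asympForms_complexForm (he.trans_isLittleO h0)
      (he.trans_isLittleO h2) (hα.trans_isLittleO h0) (hα.trans_isLittleO h2) hform
      (flatConeForm_eq β)⟩
  · obtain ⟨hCG, hP, hA⟩ := hdata.logarithmic hC hw
    have hrho : ∀ᶠ ζ : ℂ in 𝓝[≠] 0, rho ζ < 0 :=
      eventually_punctured_iff.2 ⟨0, fun x hx y => by rwa [rho_polarExp]⟩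
    have hlittle {f : ℂ → ℂ} (hf : Tendsto (fun ζ => rho ζ * ‖f ζ‖) (𝓝[≠] 0) (𝓝 0)) :
        f =o[𝓝[≠] 0] fun ζ => (rho ζ)⁻¹ := by
      refine IsLittleO.of_norm_left (isLittleO_of_tendsto' ?_ ?_)
      · filter_upwards [hrho] with ζ h1 h2
        exact absurd (inv_eq_zero.1 h2) h1.ne
      · exact hf.congr fun ζ => by rw [div_inv_eq_mul, mul_comm]
    -- The modulus is 1 exactly because `C = 4 |G(0)|`.
    refine ⟨4 * Complex.I * G 0 / C, ?_, ?_⟩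
    · rw [norm_div, norm_mul, norm_mul, Complex.norm_I, Complex.norm_real,
        Real.norm_of_nonneg hC.le, div_eq_one_iff_eq hC.ne', hCG]
      simp
    · have h1 : (fun ζ => P ζ * ζ - ((((n + 1 : ℤ) : ℝ) / 2 + (rho ζ)⁻¹ / 2 : ℝ) : ℂ))
          =o[𝓝[≠] 0] fun ζ => (rho ζ)⁻¹ :=
        (hlittle hP).congr_left fun ζ => by rw [Int.cast_add, Int.cast_one]
      have h2 : (fun ζ => A ζ * (starRingEnd ℂ) ζ - -(((rho ζ)⁻¹ / 2 : ℝ)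
          * (starRingEnd ℂ) (phase (n + 1) (4 * Complex.I * G 0 / C) ζ)))
          =o[𝓝[≠] 0] fun ζ => (rho ζ)⁻¹ :=
        (hlittle hA).congr_left fun ζ => by
          push_cast
          ring
      exact asympForms_complexForm h1 h1 h2 h2 hform (logForm_eq (n + 1) _)
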